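/- There is a universal constant $C>0$ such that the following holds. Let $n\ge 2$, $m\ge n-1$ and $d_1,\dots,d_m\ge 1$ be integers, and set $d:=\max_j d_j$, $N_j:=\binom{n+d_j-1}{d_j}$ and $N:=\sum_{j=1}^m N_j$. Let $C_j=(c_{j,\alpha})_{|\alpha|=d_j}$ $(1\le j\le m)$ be independent random vectors, $C_j$ with values in $\mathbb{R}^{N_j}$, and let $K,c_0>0$ be such that for every $j$: * (Sub-Gaussian) $\mathrm{Prob}(|\langle C_j,\theta\rangle|\ge t)\le 2e^{-t^2/K^2}$ for all unit vectors $\theta\in\mathbb{R}^{N_j}$ and all $t>0$; * (Small Ball) $\mathrm{Prob}(|\langle a,C_j\rangle|\le\varepsilon\|a\|_2)\le c_0\varepsilon$ for all nonzero $a\in\mathbb{R}^{N_j}$ and all $\varepsilon>0$. Let $P=(p_1,\dots,p_m)$ be the random system of homogeneous polynomials in $x=(x_1,\dots,x_n)$ given by $$p_j(x)=\sum_{|\alpha|=d_j}c_{j,\alpha}\sqrt{\tbinom{d_j}{\alpha}}\,x^\alpha .$$ For a system $P$ of real homogeneous polynomials $p_j$ of degree $d_j$, in which $b_{j,\alpha}$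 denotes the coefficient of $x^\alpha$ in $p_j$, put $\|P\|_W:=\Big(\sum_{j}\sum_{|\alpha|=d_j}|b_{j,\alpha}|^2/\binom{d_j}{\alpha}\Big)^{1/2}$. For $x\in S^{n-1}$ put $$L(P,x):=\sqrt{\sigma_{\min}\big(\Delta^{-1}DP(x)|_{T_xS^{n-1}}\big)^2+\|P(x)\|_2^2},$$ where $DP(x)$ is the Jacobian matrix, $T_xS^{n-1}=x^\perp$, $\Delta$ is the diagonal matrix with diagonal entries $\sqrt{d_1},\dots,\sqrt{d_m}$, and $\sigma_{\min}(T)$ is the smallest singular value of $T$, i.e. the square root of the smallest eigenvalue of $T^\top T$. Finally put $$\tilde\kappa(P):=\sup_{x\in S^{n-1}}\frac{\|P\|_W}{L(P,x)}\in[0,\infty],$$ the quotient being $\infty$ where $L(P,x)=0$. Write $r:=m-n+\tfrac32$, $\ell:=m\log(ed)$ and $$M:=\sqrt{\tfrac{N}{m}}\,(Kc_0C)^{\frac{m}{r}}\,\big(3d^2\log(ed)\big)^{\frac{n-3/2}{r}}\,n^{\frac{1}{2m-2n+3}}\,\max\Big\{d^6,\frac{n}{d^2}\Big\}.$$ Then: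 1. If $N\ge \ell$, then $$\mathrm{Prob}(\tilde\kappa(P)\ge tM)\le\begin{cases}\dfrac{3}{t^{r}} & \text{if } 1\le t\le e^{\ell/r},\\[2mm] \dfrac{3}{t^{r}}\Big(\dfrac{r\log t}{\ell}\Big)^{\frac{n-3/2}{2}} & \text{if } e^{\ell/r}\le t\le e^{N/r},\\[2mm] \dfrac{3}{t^{r}}\Big(\dfrac{r\log t}{N}\Big)^{\frac m2}\Big(\dfrac{N}{\ell}\Big)^{\frac{n-3/2}{2}} & \text{if } t\ge e^{N/r}.\end{cases}$$ 2. If $N\le \ell$, then $$\mathrm{Prob}(\tilde\kappa(P)\ge tM)\le\begin{cases}\dfrac{3}{t^{r}} & \text{if } 1\le t\le e^{N/r},\\[2mm] \dfrac{3}{t^{r}}\Big(\dfrac{r\log t}{N}\Big)^{\frac m2} & \text{if } t\ge e^{N/r}.\end{cases}$$ -/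

import Mathlib

open MeasureTheory ProbabilityTheory

noncomputable section

/-- The exponent vectors `α = (α₁, …, αₙ)` of natural numbers with `α₁ + ⋯ + αₙ = d`. -/
abbrev WExp (n d : ℕ) : Type :=
  {α : Fin n →₀ ℕ // α ∈ (Finset.univ : Finset (Fin n)).finsuppAntidiag d}

/-- The homogeneous polynomial `∑_{|α| = d} c_α √(d choose α) x^α` with Weyl-scaled coefficient
vector `c`. -/
def weylPoly {n d : ℕ} (c : EuclideanSpace ℝ (WExp n d)) : MvPolynomial (Fin n) ℝ :=
  ∑ α : WExp n d, MvPolynomial.monomial α.1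
    (c α * Real.sqrt (Nat.multinomial Finset.univ α.1 : ℝ))

/-- The Weyl-Bombieri norm of a homogeneous polynomial `p` of degree `d` in `n` variables. -/
def weylNorm {n : ℕ} (d : ℕ) (p : MvPolynomial (Fin n) ℝ) : ℝ :=
  Real.sqrt (∑ α : WExp n d,
    |p.coeff α.1| ^ 2 / (Nat.multinomial Finset.univ α.1 : ℝ))

/-- The Weyl-Bombieri norm of a system `P = (p₁, …, p_m)`, with `pᵢ` homogeneous of degree
`deg i`. -/
def weylNormSys {n m : ℕ} (deg : Fin m → ℕ) (P : Fin m → MvPolynomial (Fin n) ℝ) : ℝ :=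
  Real.sqrt (∑ i, weylNorm (deg i) (P i) ^ 2)

/-- The value `P(x)` of a polynomial system. -/
def evalSys {n m : ℕ} (P : Fin m → MvPolynomial (Fin n) ℝ) (x : EuclideanSpace ℝ (Fin n)) :
    EuclideanSpace ℝ (Fin m) :=
  WithLp.toLp 2 fun i => MvPolynomial.eval (fun k => x k) (P i)

/-- The `m × n` Jacobian matrix of a polynomial system at `x`. -/
def jacobianSys {n m : ℕ} (P : Fin m → MvPolynomial (Fin n) ℝ) (x : EuclideanSpace ℝ (Fin n)) :
    Matrix (Fin m) (Fin n) ℝ :=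
  Matrix.of fun i k => MvPolynomial.eval (fun l => x l) (MvPolynomial.pderiv k (P i))

/-- The tangent space `T_x S^{n-1}` at a unit vector `x`: the orthogonal complement of `x`. -/
abbrev sphereTangent {n : ℕ} (x : EuclideanSpace ℝ (Fin n)) :
    Submodule ℝ (EuclideanSpace ℝ (Fin n)) :=
  (Submodule.span ℝ {x})ᗮ

/-- The linear map `Δ⁻¹ DP(x)` restricted to `T_x S^{n-1}`, where `Δ` is the diagonal matrix with
diagonal entries `√d₁, …, √d_m`. -/
def scaledTangentMap {n m : ℕ} (deg : Fin m → ℕ) (P : Fin m → MvPolynomial (Fin n) ℝ)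
    (x : EuclideanSpace ℝ (Fin n)) : sphereTangent x →ₗ[ℝ] EuclideanSpace ℝ (Fin m) :=
  (Matrix.toEuclideanLin
    ((Matrix.diagonal fun i => Real.sqrt (deg i : ℝ))⁻¹ * jacobianSys P x)).domRestrict
      (sphereTangent x)

/-- The smallest singular value of `T : E → F`. The singular values are the square roots of the
`dim E` eigenvalues of `T* T`; Mathlib lists them in decreasing order, starting with index `0`. -/
def sigmaMin {E F : Type*} [NormedAddCommGroup E] [InnerProductSpace ℝ E] [FiniteDimensional ℝ E]
    [NormedAddCommGroup F] [InnerProductSpace ℝ F] [FiniteDimensional ℝ F]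
    (T : E →ₗ[ℝ] F) : ℝ :=
  T.singularValues (Module.finrank ℝ E - 1)

/-- `L(P, x)`, the square root of `σ_min(Δ⁻¹ DP(x)|_{T_x S^{n-1}})² + ‖P(x)‖²`. -/
def condL {n m : ℕ} (deg : Fin m → ℕ) (P : Fin m → MvPolynomial (Fin n) ℝ)
    (x : EuclideanSpace ℝ (Fin n)) : ℝ :=
  Real.sqrt (sigmaMin (scaledTangentMap deg P x) ^ 2 + ‖evalSys P x‖ ^ 2)

open Classical in
/-- The local condition number `‖P‖_W / L(P, x)`, equal to `∞` where `L(P, x) = 0`. -/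
def condLocal {n m : ℕ} (deg : Fin m → ℕ) (P : Fin m → MvPolynomial (Fin n) ℝ)
    (x : EuclideanSpace ℝ (Fin n)) : ENNReal :=
  if condL deg P x = 0 then ⊤ else ENNReal.ofReal (weylNormSys deg P / condL deg P x)

/-- The global condition number for real solving, the supremum of the local one over the unit
sphere. -/
def condGlobal {n m : ℕ} (deg : Fin m → ℕ) (P : Fin m → MvPolynomial (Fin n) ℝ) : ENNReal :=
  ⨆ x ∈ Metric.sphere (0 : EuclideanSpace ℝ (Fin n)) 1, condLocal deg P x

/-- The Sub-Gaussian assumption with constant `K` on a random vector `X`. -/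
def SubGaussianVec {Ω ι : Type*} [MeasurableSpace Ω] [Fintype ι] (μ : Measure Ω)
    (X : Ω → EuclideanSpace ℝ ι) (K : ℝ) : Prop :=
  ∀ θ : EuclideanSpace ℝ ι, ‖θ‖ = 1 → ∀ t : ℝ, 0 < t →
    μ.real {ω | t ≤ |inner ℝ (X ω) θ|} ≤ 2 * Real.exp (-t ^ 2 / K ^ 2)

/-- The Small Ball assumption with constant `c₀` on a random vector `X` (for `a = 0` the inequality
could never hold for all `ε`, so `a` is nonzero). -/
def SmallBallVec {Ω ι : Type*} [MeasurableSpace Ω] [Fintype ι] (μ : Measure Ω)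
    (X : Ω → EuclideanSpace ℝ ι) (c₀ : ℝ) : Prop :=
  ∀ a : EuclideanSpace ℝ ι, a ≠ 0 → ∀ ε : ℝ, 0 < ε →
    μ.real {ω | |inner ℝ a (X ω)| ≤ ε * ‖a‖} ≤ c₀ * ε

end

/-! A large condition number forces `P` to be small on a set of controlled volume, while smallness
of `P` at any fixed point of the sphere is rare. Comparing the two by Fubini bounds the probability.

If the condition number is at least `s`, there are a unit vector `x` and a unit tangent vector `y`
with `‖P(x)‖ ≤ α` and `‖DP(x)y‖ ≤ √d α`, where `α` is of order `‖P‖_W / s`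
(`exists_small_of_le_condGlobal`). Suppose `‖P‖ ≤ γ` on the sphere. On great circles `P` is a
trigonometric polynomial of degree at most `d`, so `γ` and `d` control its increments and Taylor
remainders. Along `y` the linear term is already small, hence `P` stays below `2α` over a length of
order `√(α/γ)`; in the other `n - 2` tangent directions the length is of order `α/γ`
(`exists_large_small_set`). This produces an ellipsoid of volume of order `(α/γ)^(n - 3/2)`, up to
powers of `d`.

At a fixed point, small ball and independence give probability of order `(c₀ α / √m)^m`. Dividing by
the volume leaves `α^m (γ/α)^(n - 3/2) = α^r γ^(n - 3/2)` (`measureReal_exists_small_le`), which is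
the source of the decay `t^(-r)`.

The random quantities `‖P‖_W` and `γ` are replaced by constants through their sub-Gaussian tails
(`measureReal_weylNormSys_tail`, `measureReal_sup_evalSys_tail`). With `q = r log t`, the levels are
multiples of `K √max(N, q)` and `K √max(ℓ, q)`, so that each tail costs at most `t^(-r)`. The three
contributions give the factor 3, and the regimes of the theorem record which of the two maxima
exceed `N` and `ℓ`. -/

/-! ### Weyl coordinates: evaluation as an inner product. -/

/-- The vector `(√(d choose α) x^α)_α`, dual to the coefficient vector of `weylPoly`. -/
noncomputable def weylVec {n : ℕ} (d : ℕ) (x : EuclideanSpace ℝ (Fin n)) :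
    EuclideanSpace ℝ (WExp n d) :=
  WithLp.toLp 2 fun α => Real.sqrt (Nat.multinomial Finset.univ α.1 : ℝ) * ∏ k, x k ^ α.1 k

theorem eval_weylPoly {n d : ℕ} (c : EuclideanSpace ℝ (WExp n d)) (x : EuclideanSpace ℝ (Fin n)) :
    MvPolynomial.eval (fun k => x k) (weylPoly c) = inner ℝ c (weylVec d x) := by
  simp only [weylPoly, map_sum, MvPolynomial.eval_monomial, PiLp.inner_apply, weylVec]
  refine Finset.sum_congr rfl fun α _ => ?_
  rw [Finsupp.prod_fintype _ _ (fun i => pow_zero _)]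
  simp only [RCLike.inner_apply, conj_trivial]
  ring

theorem sum_WExp {n d : ℕ} (f : (Fin n → ℕ) → ℝ) :
    ∑ α : WExp n d, f α.1 = ∑ k ∈ Finset.univ.piAntidiag d, f k := by
  refine Finset.sum_bij (fun α _ => (α.1 : Fin n → ℕ)) ?_ ?_ ?_ ?_
  · intro α _
    have := α.2
    simp only [Finset.mem_finsuppAntidiag] at this
    simp [this.1]
  · intro a _ b _ h
    exact Subtype.ext (DFunLike.coe_injective h)
  · intro k hk
    simp only [Finset.mem_piAntidiag] at hk
    refine ⟨⟨Finsupp.equivFunOnFinite.symm k, ?_⟩, Finset.mem_univ _, ?_⟩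
    · simp [Finset.mem_finsuppAntidiag, hk.1]
    · simp
  · intro α _
    rfl

/-- This is the multinomial expansion of `(∑ x_k²)^d`. Evaluation at a point of the sphere therefore
pairs the coefficient vector with a unit vector, which is the form both probabilistic hypotheses
require. -/
theorem norm_weylVec {n : ℕ} (d : ℕ) {x : EuclideanSpace ℝ (Fin n)} (hx : ‖x‖ = 1) :
    ‖weylVec d x‖ = 1 := by
  have h : ‖weylVec d x‖ ^ 2 = 1 := by
    have h1 : ‖weylVec d x‖ ^ 2
        = ∑ α : WExp n d, (Nat.multinomial Finset.univ α.1 : ℝ) * ∏ k, (x k ^ 2) ^ α.1 k := by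
      rw [EuclideanSpace.norm_sq_eq]
      refine Finset.sum_congr rfl fun α _ => ?_
      simp only [weylVec, Real.norm_eq_abs, sq_abs, mul_pow]
      rw [Real.sq_sqrt (Nat.cast_nonneg _), ← Finset.prod_pow]
      congr 1
      exact Finset.prod_congr rfl fun k _ => by ring
    have h2 : ∑ k, x k ^ 2 = 1 := by
      have := EuclideanSpace.norm_sq_eq x
      simp only [Real.norm_eq_abs, sq_abs, hx] at this
      linarith
    rw [h1, sum_WExp (fun a => (Nat.multinomial Finset.univ a : ℝ) * ∏ k, (x k ^ 2) ^ a k),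
      ← Finset.sum_pow_eq_sum_piAntidiag, h2, one_pow]
  nlinarith [norm_nonneg (weylVec d x)]

theorem coeff_weylPoly {n d : ℕ} (c : EuclideanSpace ℝ (WExp n d)) (α : WExp n d) :
    (weylPoly c).coeff α.1 = c α * Real.sqrt (Nat.multinomial Finset.univ α.1 : ℝ) := by
  classical
  rw [weylPoly, MvPolynomial.coeff_sum, Finset.sum_eq_single α]
  · simp
  · intro b _ hb
    rw [MvPolynomial.coeff_monomial, if_neg (fun h => hb (Subtype.ext h))]
  · simp

theorem weylNorm_weylPoly {n d : ℕ} (c : EuclideanSpace ℝ (WExp n d)) :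
    weylNorm d (weylPoly c) = ‖c‖ := by
  rw [weylNorm, EuclideanSpace.norm_eq]
  congr 1
  refine Finset.sum_congr rfl fun α _ => ?_
  have h : (0 : ℝ) < (Nat.multinomial Finset.univ α.1 : ℝ) := by
    exact_mod_cast Nat.multinomial_pos _ _
  rw [coeff_weylPoly, sq_abs, mul_pow, Real.sq_sqrt h.le, Real.norm_eq_abs, sq_abs]
  field_simp

theorem weylNormSys_weylPoly {n m : ℕ} (deg : Fin m → ℕ)
    (c : ∀ j, EuclideanSpace ℝ (WExp n (deg j))) :
    weylNormSys deg (fun j => weylPoly (c j)) = Real.sqrt (∑ j, ‖c j‖ ^ 2) := by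
  simp only [weylNormSys, weylNorm_weylPoly]

theorem totalDegree_weylPoly_le {n d : ℕ} (c : EuclideanSpace ℝ (WExp n d)) :
    (weylPoly c).totalDegree ≤ d := by
  refine MvPolynomial.totalDegree_finsetSum_le fun α _ => ?_
  refine (MvPolynomial.totalDegree_monomial_le _ _).trans ?_
  have := α.2
  simp only [Finset.mem_finsuppAntidiag] at this
  rw [Finsupp.sum_fintype _ _ (fun _ => rfl)]
  exact this.1.le

theorem card_WExp (n d : ℕ) :
    Fintype.card (WExp n d) = (n + d - 1).choose d := by
  have h : Fintype.card (WExp n d) = (Finset.finsuppAntidiag (Finset.univ : Finset (Fin n)) d).card :=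
    Fintype.card_coe _
  rw [h, Finset.card_finsuppAntidiag_nat_eq_choose]
  simp

/-! ### From a large condition number to a small value and a small derivative. -/

/-- The smallest singular value is attained on the unit sphere. -/
theorem exists_norm_eq_sigmaMin {E F : Type*} [NormedAddCommGroup E] [InnerProductSpace ℝ E]
    [FiniteDimensional ℝ E] [NormedAddCommGroup F] [InnerProductSpace ℝ F] [FiniteDimensional ℝ F]
    (T : E →ₗ[ℝ] F) (hE : 0 < Module.finrank ℝ E) :
    ∃ y : E, ‖y‖ = 1 ∧ ‖T y‖ = sigmaMin T := by
  obtain ⟨v, hv⟩ := (T.hasEigenvalue_adjoint_comp_self_sq_singularValues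
    (n := Module.finrank ℝ E - 1) (by omega)).exists_hasEigenvector
  have hv0 : ‖v‖ ≠ 0 := norm_ne_zero_iff.2 hv.2
  have h1 : ‖T v‖ ^ 2 = sigmaMin T ^ 2 * ‖v‖ ^ 2 := by
    have h2 := hv.apply_eq_smul
    have h3 : inner ℝ v ((LinearMap.adjoint T ∘ₗ T) v) = ‖T v‖ ^ 2 := by
      rw [LinearMap.comp_apply, LinearMap.adjoint_inner_right, real_inner_self_eq_norm_sq]
    rw [← h3, h2, inner_smul_right, real_inner_self_eq_norm_sq, sigmaMin]
    rfl
  have h4 : ‖T v‖ = sigmaMin T * ‖v‖ := by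
    have : 0 ≤ sigmaMin T := T.singularValues_nonneg _
    rw [← mul_pow] at h1
    exact (pow_left_inj₀ (norm_nonneg _) (by positivity) two_ne_zero).1 h1
  refine ⟨‖v‖⁻¹ • v, ?_, ?_⟩
  · rw [norm_smul, norm_inv, norm_norm, inv_mul_cancel₀ hv0]
  · rw [map_smul, norm_smul, norm_inv, norm_norm, h4]
    field_simp

/-- The directional derivative `DP(x) y`. -/
noncomputable def dirDeriv {n m : ℕ} (P : Fin m → MvPolynomial (Fin n) ℝ)
    (x y : EuclideanSpace ℝ (Fin n)) : EuclideanSpace ℝ (Fin m) :=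
  Matrix.toEuclideanLin (jacobianSys P x) y

theorem norm_dirDeriv_le {n m : ℕ} (deg : Fin m → ℕ) (hdeg : ∀ j, 1 ≤ deg j) {d : ℕ}
    (hd : ∀ j, deg j ≤ d) (P : Fin m → MvPolynomial (Fin n) ℝ) (x : EuclideanSpace ℝ (Fin n))
    (y : sphereTangent x) :
    ‖dirDeriv P x y‖ ≤ Real.sqrt d * ‖scaledTangentMap deg P x y‖ := by
  have hpos : ∀ i, (0 : ℝ) < Real.sqrt (deg i) := fun i =>
    Real.sqrt_pos.2 (by exact_mod_cast hdeg i)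
  have hunit : IsUnit (fun i => Real.sqrt (deg i : ℝ)) :=
    Pi.isUnit_iff.2 fun i => (hpos i).ne'.isUnit
  have h1 : ∀ i, dirDeriv P x y i = Real.sqrt (deg i) * scaledTangentMap deg P x y i := by
    intro i
    have h3 : (Matrix.diagonal fun i => Real.sqrt (deg i : ℝ))⁻¹
        = Matrix.diagonal fun i => (Real.sqrt (deg i : ℝ))⁻¹ := by
      apply Matrix.inv_eq_left_inv
      rw [Matrix.diagonal_mul_diagonal, ← Matrix.diagonal_one]
      congr 1
      funext i
      exact inv_mul_cancel₀ (hpos i).ne'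
    simp only [dirDeriv, scaledTangentMap, LinearMap.domRestrict_apply, h3,
      Matrix.toLpLin_apply, ← Matrix.mulVec_mulVec, Matrix.mulVec_diagonal]
    rw [← mul_assoc, mul_inv_cancel₀ (hpos i).ne', one_mul]
  rw [EuclideanSpace.norm_eq, EuclideanSpace.norm_eq, ← Real.sqrt_mul (Nat.cast_nonneg _)]
  apply Real.sqrt_le_sqrt
  rw [Finset.mul_sum]
  refine Finset.sum_le_sum fun i _ => ?_
  rw [h1, norm_mul, mul_pow, Real.norm_of_nonneg (hpos i).le, Real.sq_sqrt (Nat.cast_nonneg _)]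
  have : (deg i : ℝ) ≤ d := by exact_mod_cast hd i
  gcongr

theorem finrank_sphereTangent {n : ℕ} {x : EuclideanSpace ℝ (Fin n)} (hx : ‖x‖ = 1) :
    Module.finrank ℝ (sphereTangent x) + 1 = n := by
  have h1 := Submodule.finrank_add_finrank_orthogonal (Submodule.span ℝ {x})
  have h2 : Module.finrank ℝ (Submodule.span ℝ {x}) = 1 :=
    finrank_span_singleton (norm_ne_zero_iff.1 (by rw [hx]; exact one_ne_zero))
  have h3 : Module.finrank ℝ (EuclideanSpace ℝ (Fin n)) = n := finrank_euclideanSpace_fin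
  rw [h2, h3, add_comm] at h1
  exact h1

/-- A large condition number produces a point and a tangent direction at which both the system and
its directional derivative are small. -/
theorem exists_small_of_le_condGlobal {n m : ℕ} (hn : 2 ≤ n) (deg : Fin m → ℕ)
    (hdeg : ∀ j, 1 ≤ deg j) {d : ℕ} (hd : ∀ j, deg j ≤ d)
    (P : Fin m → MvPolynomial (Fin n) ℝ) {s a : ℝ} (hs : 0 < s) (ha : 2 * weylNormSys deg P ≤ a * s)
    (h : ENNReal.ofReal s ≤ condGlobal deg P) :
    ∃ x y : EuclideanSpace ℝ (Fin n), ‖x‖ = 1 ∧ ‖y‖ = 1 ∧ inner ℝ x y = 0 ∧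
      ‖evalSys P x‖ ≤ a ∧ ‖dirDeriv P x y‖ ≤ Real.sqrt d * a := by
  have hw : 0 ≤ weylNormSys deg P := Real.sqrt_nonneg _
  have ha0 : 0 ≤ a := nonneg_of_mul_nonneg_left (le_trans (by positivity) ha) hs
  -- The supremum need not be attained; halving `s` makes the inequality strict, which yields a
  -- point. This is the reason for the factor 2 in `ha`.
  have hlt : ENNReal.ofReal (s / 2) < condGlobal deg P :=
    lt_of_lt_of_le ((ENNReal.ofReal_lt_ofReal_iff hs).2 (by linarith)) h
  unfold condGlobal at hlt
  simp only [lt_iSup_iff] at hlt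
  obtain ⟨x, hx, hxl⟩ := hlt
  have hx1 : ‖x‖ = 1 := by simpa using hx
  have hL0 : 0 ≤ condL deg P x := Real.sqrt_nonneg _
  have hL : condL deg P x ≤ a := by
    unfold condLocal at hxl
    split_ifs at hxl with h0
    · rw [h0]; exact ha0
    · have hL0 : 0 < condL deg P x := lt_of_le_of_ne hL0 (Ne.symm h0)
      have h2 := (ENNReal.ofReal_lt_ofReal_iff_of_nonneg (by positivity)).1 hxl
      rw [lt_div_iff₀ hL0] at h2
      have : condL deg P x * s ≤ a * s := by nlinarith
      exact le_of_mul_le_mul_right this hs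
  have hsq : sigmaMin (scaledTangentMap deg P x) ^ 2 + ‖evalSys P x‖ ^ 2 ≤ a ^ 2 := by
    have := Real.sq_sqrt (show 0 ≤ sigmaMin (scaledTangentMap deg P x) ^ 2 + ‖evalSys P x‖ ^ 2 by
      positivity)
    rw [← this]
    exact pow_le_pow_left₀ hL0 hL 2
  obtain ⟨y, hy1, hy2⟩ := exists_norm_eq_sigmaMin (scaledTangentMap deg P x)
    (by have := finrank_sphereTangent hx1; omega)
  refine ⟨x, y, hx1, by simpa using hy1, ?_, ?_, ?_⟩
  · exact Submodule.mem_orthogonal_singleton_iff_inner_right.1 y.2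
  · exact abs_le_of_sq_le_sq' (by nlinarith [sq_nonneg (sigmaMin (scaledTangentMap deg P x))]) ha0 |>.2
  · refine (norm_dirDeriv_le deg hdeg hd P x y).trans ?_
    rw [hy2]
    gcongr
    exact abs_le_of_sq_le_sq' (by nlinarith [sq_nonneg ‖evalSys P x‖]) ha0 |>.2

/-! ### Trigonometric polynomials and Bernstein-type estimates. -/

/-- `g` is a real trigonometric polynomial of degree at most `d`. -/
def IsTrigPoly (d : ℕ) (g : ℝ → ℝ) : Prop :=
  ∃ Q : Polynomial ℂ, Q.natDegree ≤ 2 * d ∧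
    ∀ θ : ℝ, (g θ : ℂ) * Complex.exp (θ * Complex.I) ^ d = Q.eval (Complex.exp (θ * Complex.I))

namespace IsTrigPoly

theorem const (a : ℝ) : IsTrigPoly 0 fun _ => a :=
  ⟨Polynomial.C (a : ℂ), by simp, by simp⟩

theorem add {d : ℕ} {f g : ℝ → ℝ} (hf : IsTrigPoly d f) (hg : IsTrigPoly d g) :
    IsTrigPoly d fun θ => f θ + g θ := by
  obtain ⟨Q, hQ, hQe⟩ := hf
  obtain ⟨R, hR, hRe⟩ := hg
  refine ⟨Q + R, (Polynomial.natDegree_add_le _ _).trans (max_le hQ hR), fun θ => ?_⟩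
  rw [Polynomial.eval_add, ← hQe, ← hRe]
  push_cast
  ring

theorem mul {d e : ℕ} {f g : ℝ → ℝ} (hf : IsTrigPoly d f) (hg : IsTrigPoly e g) :
    IsTrigPoly (d + e) fun θ => f θ * g θ := by
  obtain ⟨Q, hQ, hQe⟩ := hf
  obtain ⟨R, hR, hRe⟩ := hg
  refine ⟨Q * R, Polynomial.natDegree_mul_le.trans (by omega), fun θ => ?_⟩
  rw [Polynomial.eval_mul, ← hQe, ← hRe]
  push_cast
  ring

theorem mono {d e : ℕ} {f : ℝ → ℝ} (hf : IsTrigPoly d f) (hde : d ≤ e) : IsTrigPoly e f := by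
  obtain ⟨Q, hQ, hQe⟩ := hf
  refine ⟨Q * Polynomial.X ^ (e - d), Polynomial.natDegree_mul_le.trans ?_, fun θ => ?_⟩
  · have := Polynomial.natDegree_X_pow_le (R := ℂ) (e - d)
    omega
  · rw [Polynomial.eval_mul, ← hQe, Polynomial.eval_pow, Polynomial.eval_X, mul_assoc, ← pow_add,
      Nat.add_sub_cancel' hde]

theorem const_mul {d : ℕ} {f : ℝ → ℝ} (a : ℝ) (hf : IsTrigPoly d f) :
    IsTrigPoly d fun θ => a * f θ := by
  simpa using (const a).mul hf

theorem sum {ι : Type*} {d : ℕ} (s : Finset ι) {f : ι → ℝ → ℝ}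
    (hf : ∀ i ∈ s, IsTrigPoly d (f i)) : IsTrigPoly d fun θ => ∑ i ∈ s, f i θ := by
  classical
  induction s using Finset.induction_on with
  | empty => simpa using (const 0).mono (Nat.zero_le d)
  | insert i s hi ih =>
    simp only [Finset.sum_insert hi]
    exact (hf i (Finset.mem_insert_self _ _)).add
      (ih fun j hj => hf j (Finset.mem_insert_of_mem hj))

theorem pow {f : ℝ → ℝ} (hf : IsTrigPoly 1 f) (k : ℕ) : IsTrigPoly k fun θ => f θ ^ k := by
  induction k with
  | zero => simpa using const 1
  | succ k ih => simpa only [pow_succ] using ih.mul hf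

theorem prod_pow {ι : Type*} (s : Finset ι) {f : ι → ℝ → ℝ} (a : ι → ℕ)
    (hf : ∀ i, IsTrigPoly 1 (f i)) : IsTrigPoly (∑ i ∈ s, a i) fun θ => ∏ i ∈ s, f i θ ^ a i := by
  classical
  induction s using Finset.induction_on with
  | empty => simpa using const 1
  | insert i s hi ih =>
    simp only [Finset.sum_insert hi, Finset.prod_insert hi]
    exact ((hf i).pow _).mul ih

theorem cos_mul_add_sin_mul (a b : ℝ) : IsTrigPoly 1 fun θ => Real.cos θ * a + Real.sin θ * b := by
  -- With `z = exp(iθ)`, one has `z cos θ = (z² + 1)/2` and `z sin θ = -i (z² - 1)/2`.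
  refine ⟨Polynomial.C (a / 2 : ℂ) * (Polynomial.X ^ 2 + 1)
    - Polynomial.C (b / 2 * Complex.I : ℂ) * (Polynomial.X ^ 2 - 1), by compute_degree,
    fun θ => ?_⟩
  have h : Complex.exp (θ * Complex.I) = Complex.cos θ + Complex.sin θ * Complex.I :=
    Complex.exp_mul_I _
  have h2 := Complex.sin_sq_add_cos_sq (θ : ℂ)
  simp only [Polynomial.eval_sub, Polynomial.eval_mul, Polynomial.eval_C, Polynomial.eval_add,
    Polynomial.eval_pow, Polynomial.eval_X, Polynomial.eval_one, h]
  push_cast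
  linear_combination (a / 2 + b / 2 * Complex.I : ℂ) * h2 +
    (-a / 2 * Complex.sin θ ^ 2 + b * Complex.sin θ * Complex.cos θ
      + b / 2 * Complex.I * Complex.sin θ ^ 2) * Complex.I_sq

theorem mvPolynomial_eval {σ : Type*} {d : ℕ} (p : MvPolynomial σ ℝ) (hp : p.totalDegree ≤ d)
    {f : σ → ℝ → ℝ} (hf : ∀ i, IsTrigPoly 1 (f i)) :
    IsTrigPoly d fun θ => MvPolynomial.eval (fun i => f i θ) p := by
  simp only [MvPolynomial.eval_eq]
  refine sum _ fun s hs => const_mul _ ((prod_pow s.support s hf).mono ?_)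
  exact (MvPolynomial.le_totalDegree hs).trans hp

end IsTrigPoly

/-- Cauchy's estimate for the coefficients of a polynomial bounded on the unit circle. -/
theorem Polynomial.norm_coeff_le_of_norm_eval_le (Q : Polynomial ℂ) {γ : ℝ}
    (h : ∀ z : ℂ, ‖z‖ = 1 → ‖Q.eval z‖ ≤ γ) (k : ℕ) : ‖Q.coeff k‖ ≤ γ := by
  have h1 : ∀ (k : ℕ) (R : Polynomial ℂ), deriv^[k] (fun z => R.eval z)
      = fun z => ((⇑Polynomial.derivative)^[k] R).eval z := by
    intro k
    induction k with
    | zero => simp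
    | succ k ih =>
      intro R
      rw [Function.iterate_succ_apply, Function.iterate_succ_apply, ← ih]
      congr 1
      funext z
      exact Polynomial.deriv R
  have h2 := Complex.norm_iteratedDeriv_le_of_forall_mem_sphere_norm_le (f := fun z => Q.eval z)
    (c := 0) (R := 1) (C := γ) k one_pos Q.differentiable.diffContOnCl
    (fun z hz => h z (by simpa using hz))
  rw [iteratedDeriv_eq_iterate, h1] at h2
  beta_reduce at h2
  rw [← Polynomial.coeff_zero_eq_eval_zero,
    Polynomial.coeff_iterate_derivative, zero_add, Nat.descFactorial_self, nsmul_eq_mul, norm_mul,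
    one_pow, div_one, Complex.norm_natCast] at h2
  exact le_of_mul_le_mul_left h2 (by exact_mod_cast k.factorial_pos)

namespace IsTrigPoly

/-- Since `|z^d| = 1` on the unit circle, the polynomial representing `g` is bounded there by `γ`,
and Cauchy's estimate bounds each Fourier coefficient. -/
theorem exists_coeff {d : ℕ} {g : ℝ → ℝ} (hg : IsTrigPoly d g) {γ : ℝ} (hγ : ∀ θ, |g θ| ≤ γ) :
    ∃ c : ℕ → ℂ, (∀ k, ‖c k‖ ≤ γ) ∧ ∀ θ : ℝ,
      (g θ : ℂ) = ∑ k ∈ Finset.range (2 * d + 1),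
        c k * Complex.exp (Complex.I * (((k : ℝ) - d) * θ : ℝ)) := by
  obtain ⟨Q, hQ, hQe⟩ := hg
  refine ⟨Q.coeff, Q.norm_coeff_le_of_norm_eval_le fun z hz => ?_, fun θ => ?_⟩
  · obtain ⟨θ, rfl⟩ := Complex.norm_eq_one_iff z |>.1 hz
    rw [← hQe, norm_mul, norm_pow, Complex.norm_exp_ofReal_mul_I, one_pow, mul_one]
    simpa using hγ θ
  · have h1 : Complex.exp (θ * Complex.I) ^ d ≠ 0 := pow_ne_zero _ (Complex.exp_ne_zero _)
    apply mul_right_cancel₀ h1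
    rw [hQe, Polynomial.eval_eq_sum_range' (Nat.lt_succ_of_le hQ), Finset.sum_mul]
    refine Finset.sum_congr rfl fun k _ => ?_
    rw [mul_assoc, ← Complex.exp_nat_mul, ← Complex.exp_nat_mul, ← Complex.exp_add]
    congr 2
    push_cast
    ring

/-- There are `2d + 1 ≤ 3d` frequencies, each of size at most `d` with coefficient at most `γ`. -/
theorem abs_sub_le {d : ℕ} {g : ℝ → ℝ} (hg : IsTrigPoly d g) (hd : 1 ≤ d) {γ : ℝ}
    (hγ : ∀ θ, |g θ| ≤ γ) (θ : ℝ) : |g θ - g 0| ≤ 3 * d ^ 2 * γ * |θ| := by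
  obtain ⟨c, hc, hce⟩ := hg.exists_coeff hγ
  have hγ0 : 0 ≤ γ := (abs_nonneg _).trans (hγ 0)
  have hd' : (1 : ℝ) ≤ d := by exact_mod_cast hd
  have h1 : ((g θ - g 0 : ℝ) : ℂ) = ∑ k ∈ Finset.range (2 * d + 1),
      c k * (Complex.exp (Complex.I * (((k : ℝ) - d) * θ : ℝ)) - 1) := by
    push_cast [hce]
    rw [← Finset.sum_sub_distrib]
    refine Finset.sum_congr rfl fun k _ => ?_
    simp
    ring
  rw [← Real.norm_eq_abs, ← Complex.norm_real, h1]
  calc ‖∑ k ∈ Finset.range (2 * d + 1),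
      c k * (Complex.exp (Complex.I * (((k : ℝ) - d) * θ : ℝ)) - 1)‖
      ≤ ∑ k ∈ Finset.range (2 * d + 1), γ * (d * |θ|) := by
        refine norm_sum_le_of_le _ fun k hk => ?_
        rw [norm_mul]
        refine mul_le_mul (hc k) (Real.norm_exp_I_mul_ofReal_sub_one_le.trans ?_) (norm_nonneg _) hγ0
        rw [Real.norm_eq_abs, abs_mul]
        gcongr
        have : (k : ℝ) ≤ 2 * d := by exact_mod_cast Nat.lt_succ_iff.1 (Finset.mem_range.1 hk)
        exact abs_le.2 ⟨by linarith [(Nat.cast_nonneg k : (0 : ℝ) ≤ k)], by linarith⟩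
    _ = (2 * d + 1) * (γ * (d * |θ|)) := by simp
    _ ≤ (3 * d) * (γ * (d * |θ|)) := by gcongr; linarith
    _ = 3 * d ^ 2 * γ * |θ| := by ring

/-- The second-order analogue: `|exp w - 1 - w| ≤ |w|²` is applied to each frequency, and `d |θ| ≤
1` keeps every exponent in the range of that bound. -/
theorem abs_sub_sub_le {d : ℕ} {g : ℝ → ℝ} (hg : IsTrigPoly d g) (hd : 1 ≤ d) {γ D : ℝ}
    (hγ : ∀ θ, |g θ| ≤ γ) (hD : HasDerivAt g D 0) {θ : ℝ} (hθ : d * |θ| ≤ 1) :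
    |g θ - g 0 - θ * D| ≤ 3 * d ^ 3 * γ * θ ^ 2 := by
  obtain ⟨c, hc, hce⟩ := hg.exists_coeff hγ
  have hγ0 : 0 ≤ γ := (abs_nonneg _).trans (hγ 0)
  have hd' : (1 : ℝ) ≤ d := by exact_mod_cast hd
  have hDc : (D : ℂ) = ∑ k ∈ Finset.range (2 * d + 1), c k * (Complex.I * ((k : ℝ) - d : ℝ)) := by
    have h1 : HasDerivAt (fun θ : ℝ => (g θ : ℂ)) (D : ℂ) 0 := hD.ofReal_comp
    refine h1.unique ?_
    simp only [hce]
    refine HasDerivAt.fun_sum fun k _ => HasDerivAt.const_mul _ ?_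
    have h2 : HasDerivAt (fun θ : ℝ => Complex.I * (((k : ℝ) - d) * θ : ℝ))
        (Complex.I * ((k : ℝ) - d : ℝ)) 0 := by
      refine HasDerivAt.const_mul _ ?_
      have := ((hasDerivAt_id (0 : ℝ)).const_mul ((k : ℝ) - d)).ofReal_comp
      simpa using this
    simpa using h2.cexp
  have h1 : ((g θ - g 0 - θ * D : ℝ) : ℂ) = ∑ k ∈ Finset.range (2 * d + 1),
      c k * (Complex.exp (Complex.I * (((k : ℝ) - d) * θ : ℝ)) - 1
        - Complex.I * (((k : ℝ) - d) * θ : ℝ)) := by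
    push_cast [hce, hDc]
    rw [← Finset.sum_sub_distrib, Finset.mul_sum, ← Finset.sum_sub_distrib]
    refine Finset.sum_congr rfl fun k _ => ?_
    simp
    ring
  rw [← Real.norm_eq_abs, ← Complex.norm_real, h1]
  calc ‖∑ k ∈ Finset.range (2 * d + 1),
      c k * (Complex.exp (Complex.I * (((k : ℝ) - d) * θ : ℝ)) - 1
        - Complex.I * (((k : ℝ) - d) * θ : ℝ))‖
      ≤ ∑ k ∈ Finset.range (2 * d + 1), γ * (d * |θ|) ^ 2 := by
        refine norm_sum_le_of_le _ fun k hk => ?_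
        have hle : ‖Complex.I * (((k : ℝ) - d) * θ : ℝ)‖ ≤ d * |θ| := by
          rw [norm_mul, Complex.norm_I, one_mul, Complex.norm_real, Real.norm_eq_abs, abs_mul]
          gcongr
          have : (k : ℝ) ≤ 2 * d := by exact_mod_cast Nat.lt_succ_iff.1 (Finset.mem_range.1 hk)
          exact abs_le.2 ⟨by linarith [(Nat.cast_nonneg k : (0 : ℝ) ≤ k)], by linarith⟩
        rw [norm_mul]
        refine mul_le_mul (hc k)
          ((Complex.norm_exp_sub_one_sub_id_le (hle.trans hθ)).trans ?_) (norm_nonneg _) hγ0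
        gcongr
    _ = (2 * d + 1) * (γ * (d ^ 2 * θ ^ 2)) := by simp [mul_pow]
    _ ≤ (3 * d) * (γ * (d ^ 2 * θ ^ 2)) := by gcongr; linarith
    _ = 3 * d ^ 3 * γ * θ ^ 2 := by ring

end IsTrigPoly

/-! ### Restriction of the system to great circles. -/

theorem MvPolynomial.hasDerivAt_eval {n : ℕ} (p : MvPolynomial (Fin n) ℝ) {f : Fin n → ℝ → ℝ}
    {f' : Fin n → ℝ} {t : ℝ} (hf : ∀ k, HasDerivAt (f k) (f' k) t) :
    HasDerivAt (fun θ => MvPolynomial.eval (fun k => f k θ) p)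
      (∑ k, MvPolynomial.eval (fun l => f l t) (MvPolynomial.pderiv k p) * f' k) t := by
  induction p using MvPolynomial.induction_on with
  | C a => simpa using hasDerivAt_const t a
  | add p q hp hq =>
    simp only [map_add, add_mul, Finset.sum_add_distrib]
    exact hp.add hq
  | mul_X p i hp =>
    simp only [map_mul, MvPolynomial.eval_X, Derivation.leibniz, MvPolynomial.pderiv_X, smul_eq_mul,
      map_add]
    convert! hp.mul (hf i) using 1
    simp only [add_mul, Finset.sum_add_distrib]
    rw [add_comm, Finset.sum_mul]
    congr 1
    · exact Finset.sum_congr rfl fun k _ => by ring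
    · rw [Finset.sum_eq_single i]
      · simp
      · intro k _ hk
        simp [Ne.symm hk]
      · simp

section Circle

variable {n m : ℕ} {P : Fin m → MvPolynomial (Fin n) ℝ} {d : ℕ} {γ : ℝ}

theorem norm_cos_smul_add_sin_smul {x y : EuclideanSpace ℝ (Fin n)} (hx : ‖x‖ = 1) (hy : ‖y‖ = 1)
    (hxy : inner ℝ x y = 0) (θ : ℝ) : ‖Real.cos θ • x + Real.sin θ • y‖ = 1 := by
  have h : ‖Real.cos θ • x + Real.sin θ • y‖ ^ 2 = 1 := by
    rw [norm_add_sq_real, norm_smul, norm_smul, inner_smul_left, inner_smul_right, hxy, hx, hy]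
    simp
  nlinarith [norm_nonneg (Real.cos θ • x + Real.sin θ • y)]

theorem isTrigPoly_inner_evalSys (hP : ∀ j, (P j).totalDegree ≤ d)
    (x y : EuclideanSpace ℝ (Fin n)) (u : EuclideanSpace ℝ (Fin m)) :
    IsTrigPoly d fun θ => inner ℝ u (evalSys P (Real.cos θ • x + Real.sin θ • y)) := by
  simp only [PiLp.inner_apply, evalSys, RCLike.inner_apply, conj_trivial]
  refine IsTrigPoly.sum _ fun j _ => ?_
  simp only [mul_comm _ (u.ofLp j)]
  refine IsTrigPoly.const_mul _ ?_
  exact IsTrigPoly.mvPolynomial_eval (P j) (hP j)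
    (fun k => IsTrigPoly.cos_mul_add_sin_mul (x k) (y k))

theorem hasDerivAt_inner_evalSys (x y : EuclideanSpace ℝ (Fin n)) (u : EuclideanSpace ℝ (Fin m)) :
    HasDerivAt (fun θ => inner ℝ u (evalSys P (Real.cos θ • x + Real.sin θ • y)))
      (inner ℝ u (dirDeriv P x y)) 0 := by
  simp only [PiLp.inner_apply, evalSys, RCLike.inner_apply, conj_trivial]
  refine HasDerivAt.fun_sum fun j _ => ?_
  simp only [mul_comm _ (u.ofLp j)]
  refine HasDerivAt.const_mul _ ?_
  have h := (P j).hasDerivAt_eval (f := fun k θ => Real.cos θ * x k + Real.sin θ * y k)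
    (f' := fun k => y k) (t := 0) (fun k => by
      simpa using ((Real.hasDerivAt_cos 0).mul_const (x k)).fun_add
        ((Real.hasDerivAt_sin 0).mul_const (y k)))
  convert! h using 1
  simp [dirDeriv, Matrix.toLpLin_apply, Matrix.mulVec, dotProduct, jacobianSys]

/-- Testing against unit vectors transfers the scalar estimates for trigonometric polynomials to
vector-valued systems without a loss depending on `m`. -/
theorem norm_le_of_inner_unit_le {E : Type*} [NormedAddCommGroup E] [InnerProductSpace ℝ E] {v : E}
    {b : ℝ} (hb : 0 ≤ b) (h : ∀ u : E, ‖u‖ = 1 → |inner ℝ u v| ≤ b) : ‖v‖ ≤ b := by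
  rcases eq_or_ne v 0 with rfl | hv
  · simpa using hb
  have hv0 : ‖v‖ ≠ 0 := norm_ne_zero_iff.2 hv
  have := h (‖v‖⁻¹ • v) (by rw [norm_smul, norm_inv, norm_norm, inv_mul_cancel₀ hv0])
  rw [inner_smul_left, real_inner_self_eq_norm_sq] at this
  have h2 : ‖v‖⁻¹ * ‖v‖ ^ 2 = ‖v‖ := by field_simp
  simpa [h2] using this

theorem norm_evalSys_circle_sub_le (hP : ∀ j, (P j).totalDegree ≤ d) (hd : 1 ≤ d)
    (hγ : ∀ x, ‖x‖ = 1 → ‖evalSys P x‖ ≤ γ) {x y : EuclideanSpace ℝ (Fin n)} (hx : ‖x‖ = 1)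
    (hy : ‖y‖ = 1) (hxy : inner ℝ x y = 0) (θ : ℝ) :
    ‖evalSys P (Real.cos θ • x + Real.sin θ • y) - evalSys P x‖ ≤ 3 * d ^ 2 * γ * |θ| := by
  have hγ0 : 0 ≤ γ := (norm_nonneg _).trans (hγ x hx)
  refine norm_le_of_inner_unit_le (by positivity) fun u hu => ?_
  have := (isTrigPoly_inner_evalSys hP x y u).abs_sub_le hd (γ := γ) (fun θ => by
    refine (abs_real_inner_le_norm _ _).trans ?_
    rw [hu, one_mul]
    exact hγ _ (norm_cos_smul_add_sin_smul hx hy hxy θ)) θ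
  simpa [inner_sub_right] using this

theorem norm_evalSys_circle_sub_sub_le (hP : ∀ j, (P j).totalDegree ≤ d) (hd : 1 ≤ d)
    (hγ : ∀ x, ‖x‖ = 1 → ‖evalSys P x‖ ≤ γ) {x y : EuclideanSpace ℝ (Fin n)} (hx : ‖x‖ = 1)
    (hy : ‖y‖ = 1) (hxy : inner ℝ x y = 0) {θ : ℝ} (hθ : d * |θ| ≤ 1) :
    ‖evalSys P (Real.cos θ • x + Real.sin θ • y) - evalSys P x - θ • dirDeriv P x y‖
      ≤ 3 * d ^ 3 * γ * θ ^ 2 := by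
  have hγ0 : 0 ≤ γ := (norm_nonneg _).trans (hγ x hx)
  refine norm_le_of_inner_unit_le (by positivity) fun u hu => ?_
  have := (isTrigPoly_inner_evalSys hP x y u).abs_sub_sub_le hd (γ := γ) (fun θ => by
    refine (abs_real_inner_le_norm _ _).trans ?_
    rw [hu, one_mul]
    exact hγ _ (norm_cos_smul_add_sin_smul hx hy hxy θ)) (hasDerivAt_inner_evalSys x y u) hθ
  simpa [inner_sub_right, inner_smul_right] using this

end Circle

/-! ### Geometry: sets of large volume on which the system is small or large. -/

theorem abs_arctan_le_abs (t : ℝ) : |Real.arctan t| ≤ |t| := by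
  have key : ∀ s : ℝ, 0 ≤ s → |Real.arctan s| ≤ |s| := fun s hs => by
    have h := Real.le_tan (Real.arctan_nonneg.2 hs) (Real.arctan_lt_pi_div_two s)
    rw [Real.tan_arctan] at h
    rwa [abs_of_nonneg (Real.arctan_nonneg.2 hs), abs_of_nonneg hs]
  rcases le_total 0 t with h | h
  · exact key t h
  · simpa [Real.arctan_neg] using key (-t) (by linarith)

section Geometry

variable {n m : ℕ} {P : Fin m → MvPolynomial (Fin n) ℝ} {d : ℕ} {γ : ℝ}

/-- The great-circle bound with angle replaced by chord. By Jordan's inequality the angle is at most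
`π/2 ≤ 5/3` times the chord when it does not exceed `π/2`, and `3 · 5/3 = 5`. Chords of length at
least 1 are covered by the trivial bound `2γ`. -/
theorem norm_evalSys_sub_le (hP : ∀ j, (P j).totalDegree ≤ d) (hd : 1 ≤ d)
    (hγ : ∀ x, ‖x‖ = 1 → ‖evalSys P x‖ ≤ γ) {x z : EuclideanSpace ℝ (Fin n)} (hx : ‖x‖ = 1)
    (hz : ‖z‖ = 1) : ‖evalSys P z - evalSys P x‖ ≤ 5 * d ^ 2 * γ * ‖z - x‖ := by
  have hγ0 : 0 ≤ γ := (norm_nonneg _).trans (hγ x hx)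
  have hd' : (1 : ℝ) ≤ d := by exact_mod_cast hd
  have hd2 : (1 : ℝ) ≤ (d : ℝ) ^ 2 := one_le_pow₀ hd'
  rcases le_or_gt 1 ‖z - x‖ with h1 | h1
  · calc ‖evalSys P z - evalSys P x‖ ≤ γ + γ := norm_sub_le_of_le (hγ z hz) (hγ x hx)
      _ ≤ 5 * 1 * γ * 1 := by linarith
      _ ≤ 5 * d ^ 2 * γ * ‖z - x‖ := by gcongr
  set c : ℝ := inner ℝ x z with hc
  have hchord : ‖z - x‖ ^ 2 = 2 - 2 * c := by
    rw [norm_sub_sq_real, hx, hz, real_inner_comm, ← hc]; ring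
  have hc1 : c ≤ 1 := by nlinarith [sq_nonneg ‖z - x‖]
  have hc0 : 0 ≤ c := by nlinarith [norm_nonneg (z - x)]
  set v := z - c • x with hv
  have hxv : inner ℝ x v = 0 := by
    rw [hv, inner_sub_right, inner_smul_right, real_inner_self_eq_norm_sq, hx, ← hc]; ring
  have hvsq : ‖v‖ ^ 2 = 1 - c ^ 2 := by
    rw [hv, norm_sub_sq_real, inner_smul_right, norm_smul, hx, hz, real_inner_comm, ← hc,
      Real.norm_eq_abs, mul_pow, sq_abs]
    ring
  rcases eq_or_ne v 0 with hv0 | hv0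
  · have hc2 : c = 1 := by
      rw [hv0, norm_zero] at hvsq
      nlinarith
    have : z = x := by
      rw [hc2, one_smul] at hv
      exact sub_eq_zero.1 (hv ▸ hv0)
    simp [this]
  have hvn : ‖v‖ ≠ 0 := norm_ne_zero_iff.2 hv0
  have hsin : Real.sin (Real.arccos c) = ‖v‖ := by
    rw [Real.sin_arccos, ← hvsq, Real.sqrt_sq (norm_nonneg _)]
  have hcos : Real.cos (Real.arccos c) = c := Real.cos_arccos (by linarith) hc1
  have hzeq : z = Real.cos (Real.arccos c) • x + Real.sin (Real.arccos c) • (‖v‖⁻¹ • v) := by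
    rw [hsin, hcos, smul_smul, mul_inv_cancel₀ hvn, one_smul, hv]
    abel
  have hθ0 := Real.arccos_nonneg c
  have hθ : Real.arccos c ≤ Real.pi / 2 := Real.arccos_le_pi_div_two.2 hc0
  have hle : Real.arccos c ≤ 5 / 3 * ‖z - x‖ := by
    have h2 := Real.mul_le_sin hθ0 hθ
    rw [hsin] at h2
    have h3 : ‖v‖ ≤ ‖z - x‖ := by
      refine abs_le_of_sq_le_sq' ?_ (norm_nonneg _) |>.2
      nlinarith
    have h4 : Real.arccos c = Real.pi / 2 * (2 / Real.pi * Real.arccos c) := by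
      field_simp
    rw [h4]
    have h5 : Real.pi / 2 ≤ 5 / 3 := by linarith [Real.pi_lt_d2]
    exact mul_le_mul h5 (h2.trans h3) (by positivity) (by norm_num)
  have key := norm_evalSys_circle_sub_le hP hd hγ hx (y := ‖v‖⁻¹ • v)
    (by rw [norm_smul, norm_inv, norm_norm, inv_mul_cancel₀ hvn])
    (by rw [inner_smul_right, hxv, mul_zero]) (Real.arccos c)
  rw [← hzeq, abs_of_nonneg hθ0] at key
  calc _ ≤ _ := key
    _ ≤ 3 * d ^ 2 * γ * (5 / 3 * ‖z - x‖) := by gcongr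
    _ = _ := by ring

/-- Radial projection to the unit sphere. -/
noncomputable def toSphere {E : Type*} [NormedAddCommGroup E] [NormedSpace ℝ E] (w : E) : E :=
  ‖w‖⁻¹ • w

theorem norm_toSphere {E : Type*} [NormedAddCommGroup E] [NormedSpace ℝ E] {w : E}
    (hw : 1 ≤ ‖w‖) : ‖toSphere w‖ = 1 := by
  rw [toSphere, norm_smul, norm_inv, norm_norm, inv_mul_cancel₀ (by linarith)]

theorem toSphere_smul {E : Type*} [NormedAddCommGroup E] [NormedSpace ℝ E] {x : E}
    (hx : ‖x‖ = 1) {ρ : ℝ} (hρ : 0 < ρ) : toSphere (ρ • x) = x := by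
  rw [toSphere, norm_smul, hx, mul_one, Real.norm_of_nonneg hρ.le, smul_smul,
    inv_mul_cancel₀ hρ.ne', one_smul]

theorem norm_toSphere_sub_le {E : Type*} [NormedAddCommGroup E] [NormedSpace ℝ E] {v w : E}
    (hv : 1 ≤ ‖v‖) (hw : 1 ≤ ‖w‖) : ‖toSphere v - toSphere w‖ ≤ 2 * ‖v - w‖ := by
  have h1 : toSphere v - toSphere w = ‖v‖⁻¹ • (v - w) + (‖v‖⁻¹ * (‖w‖ - ‖v‖)) • toSphere w := by
    have : (‖v‖⁻¹ * (‖w‖ - ‖v‖)) * ‖w‖⁻¹ = ‖v‖⁻¹ - ‖w‖⁻¹ := by field_simp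
    simp only [toSphere, smul_smul, this, smul_sub, sub_smul]
    abel
  have hi : ‖v‖⁻¹ ≤ 1 := inv_le_one_of_one_le₀ hv
  have hi0 : 0 ≤ ‖v‖⁻¹ := by positivity
  have h2 : |‖w‖ - ‖v‖| ≤ ‖v - w‖ := by
    rw [norm_sub_rev]; exact abs_norm_sub_norm_le w v
  rw [h1]
  refine (norm_add_le _ _).trans ?_
  rw [norm_smul, norm_smul, norm_toSphere hw, norm_mul, norm_inv, norm_norm, Real.norm_eq_abs]
  nlinarith [norm_nonneg (v - w), abs_nonneg (‖w‖ - ‖v‖)]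

/-- The linear map with eigenvalues `a` on `x`, `b` on `y` and `c` on the orthogonal complement. -/
noncomputable def stretch {E : Type*} [NormedAddCommGroup E] [InnerProductSpace ℝ E]
    (x y : E) (a b c : ℝ) : E →ₗ[ℝ] E where
  toFun v := (a * inner ℝ x v) • x + (b * inner ℝ y v) • y
    + c • (v - inner ℝ x v • x - inner ℝ y v • y)
  map_add' v w := by
    simp only [inner_add_right]
    module
  map_smul' t v := by
    simp only [inner_smul_right, RingHom.id_apply]
    module

theorem det_stretch {k : ℕ} {x y : EuclideanSpace ℝ (Fin (k + 2))} (hx : ‖x‖ = 1) (hy : ‖y‖ = 1)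
    (hxy : inner ℝ x y = 0) (a b c : ℝ) : LinearMap.det (stretch x y a b c) = a * b * c ^ k := by
  have hyx : inner ℝ y x = 0 := by rw [real_inner_comm]; exact hxy
  have hortho : Orthonormal ℝ (({0, 1} : Set (Fin (k + 2))).domRestrict
      (fun i => if i = 0 then x else y)) := by
    rw [orthonormal_iff_ite]
    rintro ⟨i, hi⟩ ⟨j, hj⟩
    rcases hi with rfl | rfl <;> rcases hj with rfl | rfl <;>
      simp [hx, hy, hxy, hyx, Subtype.ext_iff]
  obtain ⟨e, he⟩ := hortho.exists_orthonormalBasis_extension_of_card_eq (by simp)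
  have he0 : e 0 = x := by simpa using he 0 (by simp)
  have he1 : e 1 = y := by simpa using he 1 (by simp)
  have hmat : LinearMap.toMatrix e.toBasis e.toBasis (stretch x y a b c)
      = Matrix.diagonal (Fin.cons a (Fin.cons b fun _ => c)) := by
    ext i j
    rw [LinearMap.toMatrix_apply]
    have hj : stretch x y a b c (e j)
        = (Fin.cons a (Fin.cons b fun _ => c) : Fin (k + 2) → ℝ) j • e j := by
      simp only [stretch, LinearMap.coe_mk, AddHom.coe_mk, ← he0, ← he1,
        orthonormal_iff_ite.1 e.orthonormal]
      refine Fin.cases ?_ (fun j => ?_) j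
      · simp
      · refine Fin.cases ?_ (fun j => ?_) j
        · simp
        · have h1 : (1 : Fin (k + 2)) ≠ j.succ.succ := by
            rw [← Fin.succ_zero_eq_one]
            exact fun h => Fin.succ_ne_zero j (Fin.succ_injective _ h).symm
          simp [(Fin.succ_ne_zero _).symm, h1]
    simp only [OrthonormalBasis.coe_toBasis, hj, map_smul, OrthonormalBasis.coe_toBasis_repr_apply,
      Finsupp.smul_apply, Matrix.diagonal_apply, smul_eq_mul, OrthonormalBasis.repr_self]
    by_cases hij : i = j
    · subst hij; simp
    · simp [hij]
  rw [← LinearMap.det_toMatrix e.toBasis, hmat, Matrix.det_diagonal, Fin.prod_univ_succ,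
    Fin.prod_univ_succ]
  simp [mul_assoc]

/-- Second-order Taylor expansion along the great circle through `x` and `y`: the value contributes
`α`, the linear term at most `dδα ≤ α/4`, the remainder at most `α/5`. -/
theorem norm_evalSys_toSphere_plane_le (hP : ∀ j, (P j).totalDegree ≤ d) (hd : 1 ≤ d)
    (hγ : ∀ x, ‖x‖ = 1 → ‖evalSys P x‖ ≤ γ) {x y : EuclideanSpace ℝ (Fin n)} (hx : ‖x‖ = 1)
    (hy : ‖y‖ = 1) (hxy : inner ℝ x y = 0) {α δ : ℝ} (hα : 0 < α)
    (hδ : d * δ ≤ 1 / 4) (hδγ : 3 * d ^ 3 * γ * δ ^ 2 ≤ α / 5)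
    (hPx : ‖evalSys P x‖ ≤ α) (hPy : ‖dirDeriv P x y‖ ≤ Real.sqrt d * α) {l t : ℝ} (hl : 1 ≤ l)
    (ht : |t| ≤ δ) : ‖evalSys P (toSphere (l • x + t • y))‖ ≤ 3 / 2 * α := by
  have hγ0 : 0 ≤ γ := (norm_nonneg _).trans (hγ x hx)
  have hδ0 : 0 ≤ δ := (abs_nonneg t).trans ht
  have hd' : (1 : ℝ) ≤ d := by exact_mod_cast hd
  -- Projecting `l x + t y` to the sphere gives the point at angle `arctan(t / l)`; `l ≥ 1` keeps
  -- this angle within `δ`.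
  set θ := Real.arctan (t / l) with hθ
  have hθδ : |θ| ≤ δ := by
    refine (abs_arctan_le_abs _).trans ?_
    rw [abs_div, abs_of_pos (by linarith : 0 < l)]
    exact (div_le_self (abs_nonneg t) hl).trans ht
  have hcos : 0 < Real.cos θ := Real.cos_arctan_pos _
  have hsph : toSphere (l • x + t • y) = Real.cos θ • x + Real.sin θ • y := by
    have h1 : l • x + t • y = (l / Real.cos θ) • (Real.cos θ • x + Real.sin θ • y) := by
      have h2 : l / Real.cos θ * Real.sin θ = t := by
        have h3 : Real.sin θ = t / l * Real.cos θ := by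
          rw [← Real.tan_arctan (t / l), ← hθ, Real.tan_mul_cos hcos.ne']
        rw [h3]
        field_simp
      rw [smul_add, smul_smul, smul_smul, h2, div_mul_cancel₀ _ hcos.ne']
    rw [h1]
    exact toSphere_smul (norm_cos_smul_add_sin_smul hx hy hxy θ) (div_pos (by linarith) hcos)
  rw [hsph]
  have e1 : ‖evalSys P (Real.cos θ • x + Real.sin θ • y) - evalSys P x - θ • dirDeriv P x y‖
      ≤ α / 5 := by
    refine (norm_evalSys_circle_sub_sub_le hP hd hγ hx hy hxy ?_).trans (le_trans ?_ hδγ)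
    · calc d * |θ| ≤ d * δ := by gcongr
        _ ≤ 1 := by linarith
    · have : θ ^ 2 ≤ δ ^ 2 := sq_le_sq' (by linarith [(abs_le.1 hθδ).1]) (abs_le.1 hθδ).2
      gcongr
  have e2 : ‖θ • dirDeriv P x y‖ ≤ α / 4 := by
    rw [norm_smul, Real.norm_eq_abs]
    have hs : Real.sqrt d ≤ d := Real.sqrt_le_iff.2 ⟨by linarith, by nlinarith⟩
    calc |θ| * ‖dirDeriv P x y‖ ≤ δ * (d * α) := by
          gcongr
          exact hPy.trans (by gcongr)
      _ = d * δ * α := by ring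
      _ ≤ 1 / 4 * α := by gcongr
      _ = α / 4 := by ring
  have hsplit : evalSys P (Real.cos θ • x + Real.sin θ • y)
      = (evalSys P (Real.cos θ • x + Real.sin θ • y) - evalSys P x - θ • dirDeriv P x y)
        + θ • dirDeriv P x y + evalSys P x := by abel
  rw [hsplit]
  refine norm_add₃_le.trans ?_
  linarith

/-- The set of points whose radial projection has small image has large volume, as soon as the
system and one directional derivative are small at some point. -/
theorem exists_large_small_set (hn : 2 ≤ n) (hP : ∀ j, (P j).totalDegree ≤ d) (hd : 1 ≤ d)
    (hγ : ∀ x, ‖x‖ = 1 → ‖evalSys P x‖ ≤ γ) {x y : EuclideanSpace ℝ (Fin n)} (hx : ‖x‖ = 1)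
    (hy : ‖y‖ = 1) (hxy : inner ℝ x y = 0) {α δ ε : ℝ} (hα : 0 < α) (hδ0 : 0 ≤ δ) (hε0 : 0 ≤ ε)
    (hδ : d * δ ≤ 1 / 4) (hδγ : 3 * d ^ 3 * γ * δ ^ 2 ≤ α / 5) (hε : ε ≤ 1 / 4)
    (hεγ : 10 * d ^ 2 * γ * ε ≤ α / 2)
    (hPx : ‖evalSys P x‖ ≤ α) (hPy : ‖dirDeriv P x y‖ ≤ Real.sqrt d * α) :
    ∃ S : Set (EuclideanSpace ℝ (Fin n)),
      volume S = ENNReal.ofReal (1 / 4 * δ * ε ^ (n - 2)) *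
        volume (Metric.closedBall (0 : EuclideanSpace ℝ (Fin n)) 1) ∧
      ∀ w ∈ S, 1 ≤ ‖w‖ ∧ ‖w‖ ≤ 2 ∧ ‖evalSys P (toSphere w)‖ ≤ 2 * α := by
  have hγ0 : 0 ≤ γ := (norm_nonneg _).trans (hγ x hx)
  have hd' : (1 : ℝ) ≤ d := by exact_mod_cast hd
  have hyx : inner ℝ y x = 0 := by rw [real_inner_comm]; exact hxy
  -- The set is an ellipsoid centred at `5x/4` with semi-axes `1/4` along `x`, `δ` along `y` and `ε`
  -- in the remaining directions. Its `x`-coordinate stays in `[1, 3/2]`, so it lies outside the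
  -- open unit ball and radial projection is 2-Lipschitz on it.
  refine ⟨(fun v => (5 / 4 : ℝ) • x + v) ''
    (stretch x y (1 / 4) δ ε '' Metric.closedBall 0 1), ?_, ?_⟩
  · obtain ⟨k, rfl⟩ : ∃ k, n = k + 2 := ⟨n - 2, by omega⟩
    rw [Set.image_add_left, measure_preimage_add, Measure.addHaar_image_linearMap,
      det_stretch hx hy hxy, abs_of_nonneg (by positivity)]
    simp
  · rintro _ ⟨_, ⟨v, hv, rfl⟩, rfl⟩
    have hv1 : ‖v‖ ≤ 1 := by simpa using hv
    set a : ℝ := inner ℝ x v with ha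
    set b : ℝ := inner ℝ y v with hb
    set z := v - a • x - b • y with hz
    have ha1 : |a| ≤ 1 := by
      have := abs_real_inner_le_norm x v
      rw [hx, one_mul] at this
      exact this.trans hv1
    have hb1 : |b| ≤ 1 := by
      have := abs_real_inner_le_norm y v
      rw [hy, one_mul] at this
      exact this.trans hv1
    have hxz : inner ℝ x z = 0 := by
      simp only [hz, inner_sub_right, inner_smul_right, real_inner_self_eq_norm_sq, hx, hxy, ← ha]
      ring
    have hyz : inner ℝ y z = 0 := by
      simp only [hz, inner_sub_right, inner_smul_right, real_inner_self_eq_norm_sq, hy, hyx, ← hb]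
      ring
    have hz1 : ‖z‖ ≤ 1 := by
      have h1 : ‖z‖ ^ 2 = inner ℝ z v := by
        rw [← real_inner_self_eq_norm_sq]
        conv_lhs => rw [hz]
        rw [inner_sub_left, inner_sub_left, inner_smul_left, inner_smul_left, ← hz, hxz, hyz,
          real_inner_comm]
        simp
      have h2 : ‖z‖ ^ 2 ≤ ‖z‖ * 1 :=
        h1 ▸ (real_inner_le_norm z v).trans (by gcongr)
      nlinarith [norm_nonneg z]
    set l : ℝ := 5 / 4 + a / 4 with hl
    have hl1 : 1 ≤ l := by linarith [(abs_le.1 ha1).1]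
    have hl2 : l ≤ 3 / 2 := by linarith [(abs_le.1 ha1).2]
    set w₀ := l • x + (δ * b) • y with hw₀
    have hw : (5 / 4 : ℝ) • x + stretch x y (1 / 4) δ ε v = w₀ + ε • z := by
      simp only [stretch, LinearMap.coe_mk, AddHom.coe_mk, ← ha, ← hb, ← hz, hw₀, hl]
      module
    simp only [hw]
    have hδ1 : δ ≤ 1 / 4 := (le_mul_of_one_le_left hδ0 hd').trans hδ
    have hεz : ‖ε • z‖ ≤ ε := by
      rw [norm_smul, Real.norm_of_nonneg hε0]
      exact mul_le_of_le_one_right hε0 hz1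
    have hδb : |δ * b| ≤ δ := by
      rw [abs_mul, abs_of_nonneg hδ0]
      exact mul_le_of_le_one_right hδ0 hb1
    have norm_ge : ∀ u : EuclideanSpace ℝ (Fin n), inner ℝ x u = l → 1 ≤ ‖u‖ := fun u hu => by
      have := real_inner_le_norm x u
      rw [hx, one_mul, hu] at this
      linarith
    have hxw₀ : inner ℝ x w₀ = l := by
      simp [hw₀, inner_add_right, inner_smul_right, hx, hxy]
    have hw₀1 : 1 ≤ ‖w₀‖ := norm_ge _ hxw₀
    have hw1 : 1 ≤ ‖w₀ + ε • z‖ := norm_ge _ (by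
      rw [inner_add_right, inner_smul_right, hxz, hxw₀]; ring)
    refine ⟨hw1, ?_, ?_⟩
    · calc ‖w₀ + ε • z‖ ≤ ‖l • x‖ + ‖(δ * b) • y‖ + ‖ε • z‖ := norm_add₃_le
        _ ≤ 3 / 2 + 1 / 4 + 1 / 4 := by
          have h1 : ‖l • x‖ = l := by rw [norm_smul, hx, mul_one, Real.norm_of_nonneg (by linarith)]
          have h2 : ‖(δ * b) • y‖ ≤ δ := by rwa [norm_smul, hy, mul_one]
          linarith
        _ = 2 := by norm_num
    have e0 := norm_evalSys_toSphere_plane_le hP hd hγ hx hy hxy hα hδ hδγ hPx hPy hl1 hδb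
    -- Leaving the plane of `x` and `y` by at most `ε` costs `5d²γ · 2ε ≤ α/2`, on top of the `3α/2`
    -- obtained in the plane.
    have e3 : ‖evalSys P (toSphere (w₀ + ε • z)) - evalSys P (toSphere w₀)‖ ≤ α / 2 := by
      refine (norm_evalSys_sub_le hP hd hγ (norm_toSphere hw₀1) (norm_toSphere hw1)).trans ?_
      have h1 := norm_toSphere_sub_le hw1 hw₀1
      rw [add_sub_cancel_left] at h1
      calc 5 * d ^ 2 * γ * ‖toSphere (w₀ + ε • z) - toSphere w₀‖
          ≤ 5 * d ^ 2 * γ * (2 * ε) := by gcongr; linarith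
        _ = 10 * d ^ 2 * γ * ε := by ring
        _ ≤ α / 2 := hεγ
    have h13 := norm_sub_norm_le (evalSys P (toSphere (w₀ + ε • z))) (evalSys P (toSphere w₀))
    linarith

theorem continuous_evalSys (P : Fin m → MvPolynomial (Fin n) ℝ) : Continuous (evalSys P) := by
  unfold evalSys
  refine (PiLp.continuous_toLp 2 _).comp (continuous_pi fun j => ?_)
  exact (MvPolynomial.continuous_eval (P j)).comp (PiLp.continuous_ofLp 2 _)

/-- If the supremum of a system over the sphere is at least `g`, the system is at least `g / 2` at
the radial projections of the points of a large set. -/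
theorem exists_large_large_set (hP : ∀ j, (P j).totalDegree ≤ d) (hd : 1 ≤ d) {g : ℝ}
    {x₀ : EuclideanSpace ℝ (Fin n)} (hx₀ : ‖x₀‖ = 1) (hg : g ≤ ‖evalSys P x₀‖) :
    ∃ S : Set (EuclideanSpace ℝ (Fin n)),
      volume S = ENNReal.ofReal ((1 / (20 * d ^ 2)) ^ n) *
        volume (Metric.closedBall (0 : EuclideanSpace ℝ (Fin n)) 1) ∧
      ∀ w ∈ S, 1 ≤ ‖w‖ ∧ ‖w‖ ≤ 2 ∧ g / 2 ≤ ‖evalSys P (toSphere w)‖ := by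
  have hd' : (1 : ℝ) ≤ d := by exact_mod_cast hd
  have hd2 : (1 : ℝ) ≤ (d : ℝ) ^ 2 := one_le_pow₀ hd'
  -- Passing to a maximiser makes the Lipschitz constant proportional to the value itself. A ball of
  -- radius `1/(20d²)` then loses at most half of that value.
  obtain ⟨x, hx, hmax⟩ := (isCompact_sphere (0 : EuclideanSpace ℝ (Fin n)) 1).exists_isMaxOn
    ⟨x₀, by simpa using hx₀⟩ (continuous_evalSys P).norm.continuousOn
  have hx1 : ‖x‖ = 1 := by simpa using hx
  have hγ : ∀ z, ‖z‖ = 1 → ‖evalSys P z‖ ≤ ‖evalSys P x‖ := fun z hz => hmax (by simpa using hz)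
  set ρ : ℝ := 1 / (20 * d ^ 2) with hρ
  have hρ0 : 0 < ρ := by positivity
  have hρ1 : ρ ≤ 1 / 20 := by
    rw [hρ]
    apply one_div_le_one_div_of_le <;> linarith
  refine ⟨Metric.closedBall ((5 / 4 : ℝ) • x) ρ, ?_, fun w hw => ?_⟩
  · rw [Measure.addHaar_closedBall' _ _ hρ0.le, finrank_euclideanSpace_fin]
  · have hw' : ‖w - (5 / 4 : ℝ) • x‖ ≤ ρ := by simpa [dist_eq_norm] using hw
    have h5 : ‖(5 / 4 : ℝ) • x‖ = 5 / 4 := by rw [norm_smul, hx1]; norm_num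
    have h6 : |‖w‖ - 5 / 4| ≤ ρ := by
      rw [← h5]
      exact (abs_norm_sub_norm_le _ _).trans hw'
    have h7 := abs_le.1 h6
    have hw1 : 1 ≤ ‖w‖ := by linarith
    refine ⟨hw1, by linarith, ?_⟩
    have h8 := norm_toSphere_sub_le hw1 (by rw [h5]; norm_num : 1 ≤ ‖(5 / 4 : ℝ) • x‖)
    rw [toSphere_smul hx1 (by norm_num)] at h8
    have h9 := norm_evalSys_sub_le hP hd hγ hx1 (norm_toSphere hw1)
    have h10 : 5 * d ^ 2 * ‖evalSys P x‖ * ‖toSphere w - x‖ ≤ ‖evalSys P x‖ / 2 := by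
      calc 5 * d ^ 2 * ‖evalSys P x‖ * ‖toSphere w - x‖
          ≤ 5 * d ^ 2 * ‖evalSys P x‖ * (2 * ρ) := by gcongr; linarith
        _ = ‖evalSys P x‖ / 2 := by rw [hρ]; field_simp; ring
    have h11 := hγ x₀ hx₀
    have h12 := norm_sub_norm_le (evalSys P x) (evalSys P (toSphere w))
    rw [norm_sub_rev] at h12
    linarith

end Geometry

/-! ### First-moment argument, exponential moments and small-ball estimates. -/

section Probability

open scoped ENNReal

variable {Ω : Type*} [MeasurableSpace Ω] {μ : Measure Ω}

/-- A first moment argument: a random set with large measure on an event and with small covering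
probability forces the event to be unlikely. -/
theorem mul_measure_le_of_le_measure_section {E : Type*} [MeasurableSpace E] [SFinite μ]
    (ν : Measure E) [SFinite ν] {G : Set (Ω × E)} (hG : MeasurableSet G) {T : Set E}
    (hT : MeasurableSet T) {p V : ℝ≥0∞} (hp : ∀ w ∈ T, μ {ω | (ω, w) ∈ G} ≤ p) {B : Set Ω}
    (hB : ∀ ω ∈ B, V ≤ ν {w | w ∈ T ∧ (ω, w) ∈ G}) : V * μ B ≤ p * ν T := by
  have hGT : MeasurableSet (G ∩ Prod.snd ⁻¹' T) := hG.inter (measurable_snd hT)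
  have hmeas := measurable_measure_prodMk_left (ν := ν) hGT
  calc V * μ B ≤ V * μ {ω | V ≤ ν (Prod.mk ω ⁻¹' (G ∩ Prod.snd ⁻¹' T))} := by
        gcongr
        intro ω hω
        refine (hB ω hω).trans (measure_mono fun w hw => ⟨hw.2, hw.1⟩)
    _ ≤ ∫⁻ ω, ν (Prod.mk ω ⁻¹' (G ∩ Prod.snd ⁻¹' T)) ∂μ :=
        mul_meas_ge_le_lintegral hmeas V
    _ = (μ.prod ν) (G ∩ Prod.snd ⁻¹' T) := (Measure.prod_apply hGT).symm
    _ = ∫⁻ w, μ ((fun ω => (ω, w)) ⁻¹' (G ∩ Prod.snd ⁻¹' T)) ∂ν := Measure.prod_apply_symm hGT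
    _ ≤ ∫⁻ w, T.indicator (fun _ => p) w ∂ν := by
        refine lintegral_mono fun w => ?_
        by_cases hw : w ∈ T
        · rw [Set.indicator_of_mem hw]
          exact (measure_mono fun ω hω => hω.1).trans (hp w hw)
        · rw [Set.indicator_of_notMem hw]
          refine (measure_mono_null (t := ∅) (fun ω hω => hw hω.2) measure_empty).le
    _ = p * ν T := by rw [lintegral_indicator_const hT]

/-- The exponential Markov inequality for sums of independent random variables. -/
theorem measure_le_sum_le {ι : Type*} [Fintype ι] {Y : ι → Ω → ℝ} (hY : iIndepFun Y μ)
    (hm : ∀ i, Measurable (Y i)) (u : ℝ) :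
    μ {ω | u ≤ ∑ i, Y i ω} ≤
      ENNReal.ofReal (Real.exp (-u)) * ∏ i, ∫⁻ ω, ENNReal.ofReal (Real.exp (Y i ω)) ∂μ := by
  have hZ : iIndepFun (fun i ω => ENNReal.ofReal (Real.exp (Y i ω))) μ :=
    hY.comp (fun _ y => ENNReal.ofReal (Real.exp y)) fun _ => by fun_prop
  have hZm : ∀ i, Measurable fun ω => ENNReal.ofReal (Real.exp (Y i ω)) := fun i => by fun_prop
  rw [← lintegral_prod_eq_prod_lintegral_of_indepFun _ _ hZ hZm]
  have h1 : μ {ω | u ≤ ∑ i, Y i ω}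
      ≤ μ {ω | ENNReal.ofReal (Real.exp u) ≤ ∏ i, ENNReal.ofReal (Real.exp (Y i ω))} := by
    refine measure_mono fun ω hω => ?_
    simp only [Set.mem_ofPred_eq] at hω ⊢
    rw [← ENNReal.ofReal_prod_of_nonneg fun i _ => (Real.exp_pos _).le, ← Real.exp_sum]
    exact ENNReal.ofReal_le_ofReal (Real.exp_le_exp.2 hω)
  have h2 := mul_meas_ge_le_lintegral (μ := μ)
    (Finset.measurable_prod Finset.univ fun i _ => hZm i) (ENNReal.ofReal (Real.exp u))
  calc _ ≤ _ := h1
    _ = ENNReal.ofReal (Real.exp (-u)) * (ENNReal.ofReal (Real.exp u) *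
        μ {ω | ENNReal.ofReal (Real.exp u) ≤ ∏ i, ENNReal.ofReal (Real.exp (Y i ω))}) := by
        rw [← mul_assoc, ← ENNReal.ofReal_mul (Real.exp_pos _).le, ← Real.exp_add, neg_add_cancel,
          Real.exp_zero, ENNReal.ofReal_one, one_mul]
    _ ≤ _ := by
        gcongr

/-- Layer cake: `exp f = 1 + ∫₀^f exp t`, and the tail makes the second part at most `∫ 2 exp(-t) =
2`. -/
theorem lintegral_exp_le_three [IsProbabilityMeasure μ] {f : Ω → ℝ} (hf : Measurable f)
    (hf0 : ∀ ω, 0 ≤ f ω)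
    (htail : ∀ t : ℝ, 0 < t → μ {ω | t ≤ f ω} ≤ ENNReal.ofReal (2 * Real.exp (-(2 * t)))) :
    ∫⁻ ω, ENNReal.ofReal (Real.exp (f ω)) ∂μ ≤ 3 := by
  have key := lintegral_comp_eq_lintegral_meas_le_mul μ (f := f) (g := Real.exp)
    (Filter.Eventually.of_forall hf0) hf.aemeasurable
    (fun t _ => Real.continuous_exp.intervalIntegrable _ _)
    (Filter.Eventually.of_forall fun t => (Real.exp_pos t).le)
  have h1 : ∀ ω, ENNReal.ofReal (Real.exp (f ω))
      = ENNReal.ofReal (∫ t in (0 : ℝ)..f ω, Real.exp t) + 1 := by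
    intro ω
    have : 1 ≤ Real.exp (f ω) := Real.one_le_exp (hf0 ω)
    rw [integral_exp, Real.exp_zero, ← ENNReal.ofReal_one,
      ← ENNReal.ofReal_add (by linarith) zero_le_one]
    congr 1
    ring
  simp only [h1]
  rw [lintegral_add_right _ measurable_const, key]
  have h2 : ∫⁻ t in Set.Ioi (0 : ℝ), μ {a | t ≤ f a} * ENNReal.ofReal (Real.exp t)
      ≤ ∫⁻ t in Set.Ioi (0 : ℝ), ENNReal.ofReal (2 * Real.exp (-t)) := by
    refine setLIntegral_mono (by fun_prop) fun t ht => ?_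
    calc μ {a | t ≤ f a} * ENNReal.ofReal (Real.exp t)
        ≤ ENNReal.ofReal (2 * Real.exp (-(2 * t))) * ENNReal.ofReal (Real.exp t) := by
          gcongr
          exact htail t ht
      _ = ENNReal.ofReal (2 * Real.exp (-t)) := by
          rw [← ENNReal.ofReal_mul (by positivity), mul_assoc, ← Real.exp_add]
          congr 3
          ring
  have h3 : ∫⁻ t in Set.Ioi (0 : ℝ), ENNReal.ofReal (2 * Real.exp (-t)) = 2 := by
    rw [← ofReal_integral_eq_lintegral_ofReal ((integrableOn_exp_neg_Ioi 0).const_mul 2)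
      (Filter.Eventually.of_forall fun t => by positivity), integral_const_mul,
      integral_exp_neg_Ioi_zero]
    norm_num
  rw [h3] at h2
  calc _ ≤ (2 : ℝ≥0∞) + 1 := by
        gcongr
        simp
    _ = 3 := by norm_num

/-- Layer cake again. For `t ≤ 1` the event `exp(-Y²/β²) ≥ t` implies `|Y| ≤ β t^(-1/2)`, because
`-log t ≤ 1/t`; and `∫₀¹ t^(-1/2) = 2`. -/
theorem lintegral_exp_neg_sq_le {Y : Ω → ℝ} (hY : Measurable Y) {c₀ β : ℝ} (hβ : 0 < β)
    (hc₀ : 0 ≤ c₀)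
    (hball : ∀ ε : ℝ, 0 < ε → μ {ω | |Y ω| ≤ ε} ≤ ENNReal.ofReal (c₀ * ε)) :
    ∫⁻ ω, ENNReal.ofReal (Real.exp (-(Y ω ^ 2 / β ^ 2))) ∂μ ≤ ENNReal.ofReal (2 * c₀ * β) := by
  rw [lintegral_eq_lintegral_meas_le μ (Filter.Eventually.of_forall fun ω => (Real.exp_pos _).le)
    (by fun_prop)]
  have h1 : ∫⁻ t in Set.Ioi (0 : ℝ), μ {a | t ≤ Real.exp (-(Y a ^ 2 / β ^ 2))}
      ≤ ∫⁻ t in Set.Ioi (0 : ℝ), (Set.Ioc (0 : ℝ) 1).indicator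
        (fun t => ENNReal.ofReal (c₀ * β * t ^ (-(1 / 2) : ℝ))) t := by
    refine setLIntegral_mono ?_ fun t ht => ?_
    · exact Measurable.indicator (by fun_prop) measurableSet_Ioc
    have ht0 : (0 : ℝ) < t := ht
    by_cases ht1 : t ≤ 1
    · rw [Set.indicator_of_mem (show t ∈ Set.Ioc (0 : ℝ) 1 from ⟨ht0, ht1⟩)]
      have hpos : 0 < t ^ (-(1 / 2) : ℝ) := Real.rpow_pos_of_pos ht0 _
      refine (measure_mono fun ω hω => ?_).trans
        ((hball (β * t ^ (-(1 / 2) : ℝ)) (by positivity)).trans_eq (by rw [mul_assoc]))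
      simp only [Set.mem_ofPred_eq] at hω ⊢
      have h2 := (Real.log_le_iff_le_exp ht0).2 hω
      have h3 : (t ^ (-(1 / 2) : ℝ)) ^ 2 = t⁻¹ := by
        rw [← Real.rpow_natCast, ← Real.rpow_mul ht0.le, ← Real.rpow_neg_one]
        norm_num
      have h4 : -Real.log t ≤ t⁻¹ := by
        have := Real.log_le_sub_one_of_pos (inv_pos.2 ht0)
        rw [Real.log_inv] at this
        linarith
      have h5 : Y ω ^ 2 ≤ (β * t ^ (-(1 / 2) : ℝ)) ^ 2 := by
        rw [mul_pow, h3, mul_comm, ← div_le_iff₀ (by positivity)]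
        linarith
      exact abs_le_of_sq_le_sq h5 (by positivity)
    · have : {a | t ≤ Real.exp (-(Y a ^ 2 / β ^ 2))} = ∅ := by
        ext ω
        simp only [Set.mem_ofPred_eq, Set.mem_empty_iff_false, iff_false, not_le]
        refine lt_of_le_of_lt (Real.exp_le_one_iff.2 ?_) (not_le.1 ht1)
        have : 0 ≤ Y ω ^ 2 / β ^ 2 := by positivity
        linarith
      rw [this, measure_empty]
      exact zero_le
  refine h1.trans ?_
  rw [lintegral_indicator measurableSet_Ioc, Measure.restrict_restrict measurableSet_Ioc,
    Set.inter_eq_left.2 Set.Ioc_subset_Ioi_self]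
  have hint : IntegrableOn (fun t : ℝ => t ^ (-(1 / 2) : ℝ)) (Set.Ioc 0 1) :=
    (intervalIntegrable_iff_integrableOn_Ioc_of_le zero_le_one).1
      (intervalIntegral.intervalIntegrable_rpow' (by norm_num))
  rw [← ofReal_integral_eq_lintegral_ofReal (hint.const_mul _)]
  · rw [integral_const_mul, ← intervalIntegral.integral_of_le zero_le_one,
      integral_rpow (Or.inl (by norm_num))]
    apply le_of_eq
    congr 1
    norm_num
    ring
  · refine (ae_restrict_iff' measurableSet_Ioc).2 (Filter.Eventually.of_forall fun t ht => ?_)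
    have := Real.rpow_nonneg ht.1.le (-(1 / 2) : ℝ)
    simp only [Pi.zero_apply]
    positivity

variable {ι : Type*} [Fintype ι] {X : Ω → EuclideanSpace ℝ ι}

theorem SubGaussianVec.measure_le [IsProbabilityMeasure μ] {K : ℝ} (h : SubGaussianVec μ X K)
    {θ : EuclideanSpace ℝ ι} (hθ : ‖θ‖ ≤ 1) {t : ℝ} (ht : 0 < t) :
    μ {ω | t ≤ |inner ℝ (X ω) θ|} ≤ ENNReal.ofReal (2 * Real.exp (-t ^ 2 / K ^ 2)) := by
  rcases eq_or_ne θ 0 with rfl | h0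
  · have : {ω | t ≤ |inner ℝ (X ω) (0 : EuclideanSpace ℝ ι)|} = ∅ := by
      ext ω
      simp [ht]
    rw [this, measure_empty]
    exact zero_le
  have hn : 0 < ‖θ‖ := norm_pos_iff.2 h0
  have h1 := h (‖θ‖⁻¹ • θ) (by rw [norm_smul, norm_inv, norm_norm, inv_mul_cancel₀ hn.ne']) t ht
  rw [← ofReal_measureReal (measure_ne_top _ _)]
  refine ENNReal.ofReal_le_ofReal (le_trans ?_ h1)
  refine measureReal_mono (fun ω hω => ?_)
  simp only [Set.mem_ofPred_eq, inner_smul_right, abs_mul, abs_inv, abs_norm] at hω ⊢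
  exact hω.trans (le_mul_of_one_le_left (abs_nonneg _) ((one_le_inv₀ hn).2 hθ))

theorem SubGaussianVec.lintegral_exp_inner_sq_le [IsProbabilityMeasure μ] {K : ℝ} (hK : 0 < K)
    (h : SubGaussianVec μ X K) (hX : Measurable X) {θ : EuclideanSpace ℝ ι} (hθ : ‖θ‖ ≤ 1) :
    ∫⁻ ω, ENNReal.ofReal (Real.exp (inner ℝ (X ω) θ ^ 2 / (2 * K ^ 2))) ∂μ ≤ 3 := by
  refine lintegral_exp_le_three (by fun_prop) (fun ω => by positivity) fun t ht => ?_
  have hs : 0 < Real.sqrt (2 * t) * K := mul_pos (Real.sqrt_pos.2 (by linarith)) hK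
  have hsq : (Real.sqrt (2 * t) * K) ^ 2 = 2 * t * K ^ 2 := by
    rw [mul_pow, Real.sq_sqrt (by linarith)]
  have h1 := h.measure_le hθ hs
  have h2 : -(Real.sqrt (2 * t) * K) ^ 2 / K ^ 2 = -(2 * t) := by
    rw [hsq]; field_simp
  rw [h2] at h1
  refine (measure_mono fun ω hω => ?_).trans h1
  simp only [Set.mem_ofPred_eq] at hω ⊢
  rw [le_div_iff₀ (by positivity)] at hω
  refine Real.le_sqrt_of_sq_le ?_ |>.trans (Real.sqrt_sq_eq_abs _).le
  rw [hsq]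
  linarith

/-- Volume averaging in place of a net. A ball of radius `1/4` inside the unit ball consists of
directions `θ` with `⟨c, θ⟩ ≥ ‖c‖/2`, so `exp(‖c‖²/8K²)` is at most `4^dim` times the average of
`exp(⟨c, θ⟩²/2K²)` over the unit ball. Fubini then reduces the claim to the one-dimensional moment.
-/
theorem SubGaussianVec.lintegral_exp_norm_sq_le [IsProbabilityMeasure μ] {K : ℝ} (hK : 0 < K)
    (h : SubGaussianVec μ X K) (hX : Measurable X) :
    ∫⁻ ω, ENNReal.ofReal (Real.exp (‖X ω‖ ^ 2 / (8 * K ^ 2))) ∂μ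
      ≤ 3 * 4 ^ Fintype.card ι := by
  set B : Set (EuclideanSpace ℝ ι) := Metric.closedBall 0 1 with hB
  have hB0 : volume B ≠ 0 := (Metric.measure_closedBall_pos volume _ one_pos).ne'
  have hBt : volume B ≠ ∞ := measure_closedBall_lt_top.ne
  have hvol : ∀ c : EuclideanSpace ℝ ι, 4 ^ Fintype.card ι * volume (Metric.closedBall c (1 / 4))
      = volume B := fun c => by
    rw [Measure.addHaar_closedBall' _ _ (by norm_num : (0 : ℝ) ≤ 1 / 4), finrank_euclideanSpace,
      ← mul_assoc, ← hB]
    rw [ENNReal.ofReal_pow (by norm_num), ← mul_pow,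
      show (4 : ℝ≥0∞) = ENNReal.ofReal 4 by simp, ← ENNReal.ofReal_mul (by norm_num)]
    norm_num
  have hpt : ∀ c : EuclideanSpace ℝ ι,
      volume B * ENNReal.ofReal (Real.exp (‖c‖ ^ 2 / (8 * K ^ 2))) ≤ 4 ^ Fintype.card ι *
        ∫⁻ θ in B, ENNReal.ofReal (Real.exp (inner ℝ c θ ^ 2 / (2 * K ^ 2))) := fun c => by
    set u := toSphere c with hu
    -- Equality fails for `c = 0`, where `u = 0`; only the inequality is needed.
    have hu1 : ‖u‖ ≤ 1 := by
      rw [hu, toSphere, norm_smul, norm_inv, norm_norm]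
      exact inv_mul_le_one
    have hcu : inner ℝ c u = ‖c‖ := by
      rw [hu, toSphere, inner_smul_right, real_inner_self_eq_norm_sq]
      rcases eq_or_ne ‖c‖ 0 with h0 | h0
      · simp [h0]
      · field_simp
    have hsub : Metric.closedBall ((3 / 4 : ℝ) • u) (1 / 4) ⊆ B := by
      refine Metric.closedBall_subset_closedBall' ?_
      rw [dist_zero_right, norm_smul, Real.norm_of_nonneg (by norm_num)]
      linarith
    calc volume B * ENNReal.ofReal (Real.exp (‖c‖ ^ 2 / (8 * K ^ 2)))
        = 4 ^ Fintype.card ι * ∫⁻ _ in Metric.closedBall ((3 / 4 : ℝ) • u) (1 / 4),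
            ENNReal.ofReal (Real.exp (‖c‖ ^ 2 / (8 * K ^ 2))) := by
          rw [setLIntegral_const, ← hvol ((3 / 4 : ℝ) • u)]
          ring
      _ ≤ 4 ^ Fintype.card ι * ∫⁻ θ in Metric.closedBall ((3 / 4 : ℝ) • u) (1 / 4),
            ENNReal.ofReal (Real.exp (inner ℝ c θ ^ 2 / (2 * K ^ 2))) := by
          gcongr 4 ^ Fintype.card ι * ?_
          refine setLIntegral_mono (by fun_prop) fun θ hθ => ?_
          apply ENNReal.ofReal_le_ofReal
          apply Real.exp_le_exp.2
          have hθ' : ‖θ - (3 / 4 : ℝ) • u‖ ≤ 1 / 4 := by simpa [dist_eq_norm] using hθ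
          have h1 : inner ℝ c θ = 3 / 4 * ‖c‖ + inner ℝ c (θ - (3 / 4 : ℝ) • u) := by
            rw [inner_sub_right, inner_smul_right, hcu]; ring
          have h2 : |inner ℝ c (θ - (3 / 4 : ℝ) • u)| ≤ ‖c‖ * (1 / 4) :=
            (abs_real_inner_le_norm _ _).trans (by gcongr)
          have h3 : ‖c‖ / 2 ≤ inner ℝ c θ := by linarith [(abs_le.1 h2).1]
          have h4 : (‖c‖ / 2) ^ 2 ≤ inner ℝ c θ ^ 2 := by gcongr
          rw [div_le_div_iff₀ (by positivity) (by positivity)]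
          nlinarith [sq_nonneg K]
      _ ≤ _ := by gcongr
  have h1 : volume B * ∫⁻ ω, ENNReal.ofReal (Real.exp (‖X ω‖ ^ 2 / (8 * K ^ 2))) ∂μ
      ≤ volume B * (3 * 4 ^ Fintype.card ι) := by
    calc volume B * ∫⁻ ω, ENNReal.ofReal (Real.exp (‖X ω‖ ^ 2 / (8 * K ^ 2))) ∂μ
        = ∫⁻ ω, volume B * ENNReal.ofReal (Real.exp (‖X ω‖ ^ 2 / (8 * K ^ 2))) ∂μ :=
          (lintegral_const_mul _ (by fun_prop)).symm
      _ ≤ ∫⁻ ω, 4 ^ Fintype.card ι *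
          (∫⁻ θ in B, ENNReal.ofReal (Real.exp (inner ℝ (X ω) θ ^ 2 / (2 * K ^ 2)))) ∂μ :=
          lintegral_mono fun ω => hpt (X ω)
      _ = 4 ^ Fintype.card ι * ∫⁻ ω,
          (∫⁻ θ in B, ENNReal.ofReal (Real.exp (inner ℝ (X ω) θ ^ 2 / (2 * K ^ 2)))) ∂μ :=
          lintegral_const_mul' _ _ (by simp)
      _ = 4 ^ Fintype.card ι * ∫⁻ θ in B,
          ∫⁻ ω, ENNReal.ofReal (Real.exp (inner ℝ (X ω) θ ^ 2 / (2 * K ^ 2))) ∂μ := by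
          rw [lintegral_lintegral_swap]
          refine Measurable.aemeasurable ?_
          simp only [Function.uncurry_def]
          fun_prop
      _ ≤ 4 ^ Fintype.card ι * ∫⁻ θ in B, 3 := by
          gcongr 4 ^ Fintype.card ι * ?_
          refine setLIntegral_mono measurable_const fun θ hθ => ?_
          exact h.lintegral_exp_inner_sq_le hK hX (by simpa [hB] using hθ)
      _ = _ := by
          rw [setLIntegral_const]
          ring
  exact (ENNReal.mul_le_mul_iff_right hB0 hBt).1 h1

theorem SmallBallVec.lintegral_exp_neg_inner_sq_le [IsProbabilityMeasure μ] {c₀ : ℝ}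
    (hc₀ : 0 ≤ c₀) (h : SmallBallVec μ X c₀) (hX : Measurable X) {a : EuclideanSpace ℝ ι}
    (ha : ‖a‖ = 1) {β : ℝ} (hβ : 0 < β) :
    ∫⁻ ω, ENNReal.ofReal (Real.exp (-(inner ℝ (X ω) a ^ 2 / β ^ 2))) ∂μ
      ≤ ENNReal.ofReal (2 * c₀ * β) := by
  have ha0 : a ≠ 0 := norm_ne_zero_iff.1 (by rw [ha]; exact one_ne_zero)
  refine lintegral_exp_neg_sq_le (by fun_prop) hβ hc₀ fun ε hε => ?_
  have := h a ha0 ε hε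
  rw [ha, mul_one] at this
  rw [← ofReal_measureReal (measure_ne_top _ _)]
  simp only [real_inner_comm a]
  exact ENNReal.ofReal_le_ofReal this

end Probability

/-! ### Tail and small-ball bounds for the random system. -/

section System

open scoped ENNReal

/-- The first-moment argument on the shell `1 ≤ ‖w‖ ≤ 2`, whose volume is at most `2^n` times that
of the unit ball. The event `B` may be non-measurable: it is contained in the measurable event that
the section of `G` over the shell is large. -/
theorem measureReal_le_of_volume {Ω : Type*} [MeasurableSpace Ω] {μ : Measure Ω}
    [IsFiniteMeasure μ] {n : ℕ} {G : Set (Ω × EuclideanSpace ℝ (Fin n))} (hG : MeasurableSet G)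
    {p v : ℝ} (hp0 : 0 ≤ p) (hv : 0 < v)
    (hp : ∀ w, 1 ≤ ‖w‖ → μ {ω | (ω, w) ∈ G} ≤ ENNReal.ofReal p) {B : Set Ω}
    (hB : ∀ ω ∈ B, ∃ S : Set (EuclideanSpace ℝ (Fin n)), volume S = ENNReal.ofReal v *
        volume (Metric.closedBall (0 : EuclideanSpace ℝ (Fin n)) 1) ∧
      ∀ w ∈ S, 1 ≤ ‖w‖ ∧ ‖w‖ ≤ 2 ∧ (ω, w) ∈ G) : μ.real B ≤ p * 2 ^ n / v := by
  set b := volume (Metric.closedBall (0 : EuclideanSpace ℝ (Fin n)) 1) with hb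
  have hb0 : b ≠ 0 := (Metric.measure_closedBall_pos volume _ one_pos).ne'
  have hbt : b ≠ ∞ := measure_closedBall_lt_top.ne
  have hT : MeasurableSet {w : EuclideanSpace ℝ (Fin n) | 1 ≤ ‖w‖ ∧ ‖w‖ ≤ 2} :=
    (measurableSet_le measurable_const measurable_norm).inter
      (measurableSet_le measurable_norm measurable_const)
  have h1 := mul_measure_le_of_le_measure_section (μ := μ) volume hG hT (fun w hw => hp w hw.1)
    (V := ENNReal.ofReal v * b) (B := B) fun ω hω => by
      obtain ⟨S, hS, hS'⟩ := hB ω hω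
      rw [← hS]
      exact measure_mono fun w hw => ⟨⟨(hS' w hw).1, (hS' w hw).2.1⟩, (hS' w hw).2.2⟩
  have h2 : volume {w : EuclideanSpace ℝ (Fin n) | 1 ≤ ‖w‖ ∧ ‖w‖ ≤ 2}
      ≤ ENNReal.ofReal (2 ^ n) * b := by
    have h := Measure.addHaar_closedBall' volume (0 : EuclideanSpace ℝ (Fin n))
      (by norm_num : (0 : ℝ) ≤ 2)
    rw [finrank_euclideanSpace_fin] at h
    rw [hb, ← h]
    exact measure_mono fun w hw => by simpa using hw.2
  have h3 : b * (ENNReal.ofReal v * μ B) ≤ b * ENNReal.ofReal (p * 2 ^ n) := by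
    calc b * (ENNReal.ofReal v * μ B) = ENNReal.ofReal v * b * μ B := by ring
      _ ≤ ENNReal.ofReal p * (ENNReal.ofReal (2 ^ n) * b) := h1.trans (by gcongr)
      _ = b * ENNReal.ofReal (p * 2 ^ n) := by rw [ENNReal.ofReal_mul hp0]; ring
  have h4 := (ENNReal.mul_le_mul_iff_right hb0 hbt).1 h3
  rw [le_div_iff₀ hv, mul_comm]
  rw [← ofReal_measureReal (measure_ne_top _ _), ← ENNReal.ofReal_mul hv.le] at h4
  exact (ENNReal.ofReal_le_ofReal_iff (by positivity)).1 h4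

/-- At scale `2K` the two hypotheses compete: one coordinate is either at least `2K`, with
probability at most `2e⁻⁴ ≤ 1/2`, or at most `2K`, with probability at most `2Kc₀`. This makes the
base `K c₀ C` of the normalizer at least 1. -/
theorem one_fourth_le_mul_of_subGaussian_smallBall {Ω ι : Type*} [MeasurableSpace Ω] [Fintype ι]
    [Nonempty ι] {μ : Measure Ω} [IsProbabilityMeasure μ] {X : Ω → EuclideanSpace ℝ ι} {K c₀ : ℝ}
    (hK : 0 < K) (hsg : SubGaussianVec μ X K) (hsb : SmallBallVec μ X c₀) : 1 / 4 ≤ K * c₀ := by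
  classical
  obtain ⟨i⟩ := ‹Nonempty ι›
  set θ : EuclideanSpace ℝ ι := EuclideanSpace.single i 1 with hθ
  have hθ1 : ‖θ‖ = 1 := by simp [hθ]
  have h1 := hsg θ hθ1 (2 * K) (by linarith)
  have h2 := hsb θ (norm_ne_zero_iff.1 (by rw [hθ1]; exact one_ne_zero)) (2 * K) (by linarith)
  rw [hθ1, mul_one] at h2
  have h3 : (1 : ℝ) ≤ μ.real {ω | 2 * K ≤ |inner ℝ (X ω) θ|}
      + μ.real {ω | |inner ℝ θ (X ω)| ≤ 2 * K} := by
    rw [← probReal_univ (μ := μ)]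
    refine (measureReal_mono fun ω _ => ?_).trans (measureReal_union_le _ _)
    rcases le_total (2 * K) |inner ℝ (X ω) θ| with h | h
    · exact Or.inl h
    · exact Or.inr (by rwa [real_inner_comm] at h)
  have h4 : -(2 * K) ^ 2 / K ^ 2 = -4 := by field_simp; norm_num
  have h5 : Real.exp (-4) ≤ 1 / 4 := by
    have := Real.add_one_le_exp (4 : ℝ)
    rw [Real.exp_neg, one_div]
    exact inv_anti₀ (by norm_num) (by linarith)
  rw [h4] at h1
  linarith

variable {n m : ℕ} {deg : Fin m → ℕ} {Ω : Type*} [MeasurableSpace Ω] {μ : Measure Ω}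
  [IsProbabilityMeasure μ] {X : ∀ j : Fin m, Ω → EuclideanSpace ℝ (WExp n (deg j))} {K c₀ : ℝ}

theorem evalSys_weylPoly_apply (c : ∀ j, EuclideanSpace ℝ (WExp n (deg j)))
    (x : EuclideanSpace ℝ (Fin n)) (j : Fin m) :
    evalSys (fun j => weylPoly (c j)) x j = inner ℝ (c j) (weylVec (deg j) x) :=
  eval_weylPoly (c j) x

theorem norm_evalSys_weylPoly_sq (c : ∀ j, EuclideanSpace ℝ (WExp n (deg j)))
    (x : EuclideanSpace ℝ (Fin n)) :
    ‖evalSys (fun j => weylPoly (c j)) x‖ ^ 2 = ∑ j, inner ℝ (c j) (weylVec (deg j) x) ^ 2 := by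
  rw [EuclideanSpace.norm_sq_eq]
  simp only [evalSys_weylPoly_apply, Real.norm_eq_abs, sq_abs]

theorem measurable_weylVec (d : ℕ) :
    Measurable (weylVec d : EuclideanSpace ℝ (Fin n) → EuclideanSpace ℝ (WExp n d)) := by
  unfold weylVec
  fun_prop

theorem measurable_toSphere :
    Measurable (toSphere : EuclideanSpace ℝ (Fin n) → EuclideanSpace ℝ (Fin n)) := by
  unfold toSphere
  fun_prop

theorem measurable_evalSys_toSphere (hX : ∀ j, Measurable (X j)) :
    Measurable fun p : Ω × EuclideanSpace ℝ (Fin n) =>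
      evalSys (fun j => weylPoly (X j p.1)) (toSphere p.2) := by
  refine (WithLp.measurable_toLp 2 _).comp (measurable_pi_lambda _ fun j => ?_)
  simp only [eval_weylPoly]
  exact ((hX j).comp measurable_fst).inner
    ((measurable_weylVec _).comp (measurable_toSphere.comp measurable_snd))

theorem measure_le_norm_evalSys_le (hX : ∀ j, Measurable (X j)) (hind : iIndepFun X μ) (hK : 0 < K)
    (hsg : ∀ j, SubGaussianVec μ (X j) K) {x : EuclideanSpace ℝ (Fin n)} (hx : ‖x‖ = 1) {g : ℝ}
    (hg : 0 ≤ g) : μ {ω | g ≤ ‖evalSys (fun j => weylPoly (X j ω)) x‖} ≤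
      ENNReal.ofReal (Real.exp (-(g ^ 2 / (2 * K ^ 2))) * 3 ^ m) := by
  have h1 := measure_le_sum_le (Y := fun j ω => inner ℝ (X j ω) (weylVec (deg j) x) ^ 2 / (2 * K ^ 2))
    (hind.comp (fun j c => inner ℝ c (weylVec (deg j) x) ^ 2 / (2 * K ^ 2)) fun j => by fun_prop)
    (fun j => by have := hX j; fun_prop) (g ^ 2 / (2 * K ^ 2))
  refine (measure_mono fun ω hω => ?_).trans (h1.trans ?_)
  · simp only [Set.mem_ofPred_eq] at hω ⊢
    rw [← Finset.sum_div, ← norm_evalSys_weylPoly_sq]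
    gcongr
  · rw [ENNReal.ofReal_mul (Real.exp_pos _).le, ENNReal.ofReal_pow (by norm_num)]
    gcongr
    refine (Finset.prod_le_pow_card _ _ 3 fun j _ => ?_).trans (by simp)
    exact (hsg j).lintegral_exp_inner_sq_le hK (hX j) (norm_weylVec _ hx).le

/-- Tensorization of the small-ball property, through the Laplace transform of a sum of independent
squares. -/
theorem measure_norm_evalSys_le_le (hm : 1 ≤ m) (hX : ∀ j, Measurable (X j)) (hind : iIndepFun X μ)
    (hc₀ : 0 < c₀) (hsb : ∀ j, SmallBallVec μ (X j) c₀) {x : EuclideanSpace ℝ (Fin n)}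
    (hx : ‖x‖ = 1) {b : ℝ} (hb : 0 < b) : μ {ω | ‖evalSys (fun j => weylPoly (X j ω)) x‖ ≤ b} ≤
      ENNReal.ofReal ((2 * Real.exp 1 * c₀ * b / Real.sqrt m) ^ m) := by
  have hm0 : (0 : ℝ) < m := by exact_mod_cast hm
  have hs : 0 < Real.sqrt m := Real.sqrt_pos.2 hm0
  -- At this scale the event says that the rescaled squares sum to at most `m`, so Markov's
  -- inequality costs `e` per coordinate.
  set β : ℝ := b / Real.sqrt m with hβ
  have hβ0 : 0 < β := by positivity
  have h1 := measure_le_sum_le (Y := fun j ω => -(inner ℝ (X j ω) (weylVec (deg j) x) ^ 2 / β ^ 2))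
    (hind.comp (fun j c => -(inner ℝ c (weylVec (deg j) x) ^ 2 / β ^ 2)) fun j => by fun_prop)
    (fun j => by have := hX j; fun_prop) (-m)
  refine (measure_mono fun ω hω => ?_).trans (h1.trans ?_)
  · simp only [Set.mem_ofPred_eq] at hω ⊢
    rw [Finset.sum_neg_distrib, ← Finset.sum_div, ← norm_evalSys_weylPoly_sq, neg_le_neg_iff,
      div_le_iff₀ (by positivity), hβ, div_pow, Real.sq_sqrt hm0.le, mul_div_cancel₀ _ hm0.ne']
    gcongr
  · have h2 : (2 * Real.exp 1 * c₀ * b / Real.sqrt m) ^ m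
        = Real.exp (- -m) * (2 * c₀ * β) ^ m := by
      rw [neg_neg, ← mul_one (m : ℝ), Real.exp_nat_mul, ← mul_pow, hβ, mul_one]
      congr 1
      ring
    rw [h2, ENNReal.ofReal_mul (Real.exp_pos _).le, ENNReal.ofReal_pow (by positivity)]
    gcongr
    refine (Finset.prod_le_pow_card _ _ (ENNReal.ofReal (2 * c₀ * β)) fun j _ => ?_).trans (by simp)
    exact (hsb j).lintegral_exp_neg_inner_sq_le hc₀.le (hX j) (norm_weylVec _ hx) hβ0

theorem measureReal_weylNormSys_tail (hn : 1 ≤ n) (hX : ∀ j, Measurable (X j))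
    (hind : iIndepFun X μ) (hK : 0 < K) (hsg : ∀ j, SubGaussianVec μ (X j) K) {N : ℕ}
    (hN : N = ∑ j, (n + deg j - 1).choose (deg j)) (u : ℝ) (hu : 0 ≤ u) :
    μ.real {ω | Real.sqrt (8 * u) * K ≤ weylNormSys deg fun j => weylPoly (X j ω)}
      ≤ Real.exp (-u) * 12 ^ N := by
  have h1 := measure_le_sum_le (Y := fun j ω => ‖X j ω‖ ^ 2 / (8 * K ^ 2))
    (hind.comp (fun j c => ‖c‖ ^ 2 / (8 * K ^ 2)) fun j => by fun_prop)
    (fun j => by have := hX j; fun_prop) u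
  have h2 : ∏ j, ∫⁻ ω, ENNReal.ofReal (Real.exp (‖X j ω‖ ^ 2 / (8 * K ^ 2))) ∂μ
      ≤ ENNReal.ofReal (12 ^ N) := by
    rw [hN, ENNReal.ofReal_pow (by norm_num), ← Finset.prod_pow_eq_pow_sum]
    refine Finset.prod_le_prod' fun j _ => ?_
    refine ((hsg j).lintegral_exp_norm_sq_le hK (hX j)).trans ?_
    -- Each block has dimension `N_j ≥ 1`, hence `3 · 4^N_j ≤ 12^N_j` and the blocks multiply to
    -- `12^N`.
    have hpos : (n + deg j - 1).choose (deg j) ≠ 0 :=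
      (Nat.choose_pos (by omega)).ne'
    rw [card_WExp, show ENNReal.ofReal 12 = 3 * 4 by norm_num, mul_pow]
    gcongr
    exact le_self_pow₀ (by norm_num) hpos
  rw [measureReal_def]
  refine ENNReal.toReal_le_of_le_ofReal (by positivity) ?_
  rw [ENNReal.ofReal_mul (Real.exp_pos _).le]
  refine (measure_mono fun ω hω => ?_).trans (h1.trans (by gcongr))
  simp only [Set.mem_ofPred_eq, weylNormSys_weylPoly] at hω ⊢
  rw [← Finset.sum_div, le_div_iff₀ (by positivity)]
  have h3 := (Real.le_sqrt (by positivity) (by positivity)).1 hω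
  rw [mul_pow, Real.sq_sqrt (by positivity)] at h3
  linarith

/-- A large value at one point persists, up to a factor 2, on a ball of relative volume
`(20d²)^(-n)`; the shell contributes the remaining `2^n`. -/
theorem measureReal_sup_evalSys_tail {d : ℕ} (hd : 1 ≤ d) (hdeg : ∀ j, deg j ≤ d)
    (hX : ∀ j, Measurable (X j)) (hind : iIndepFun X μ) (hK : 0 < K)
    (hsg : ∀ j, SubGaussianVec μ (X j) K) {g : ℝ} (hg : 0 ≤ g) :
    μ.real {ω | ∃ x, ‖x‖ = 1 ∧ g ≤ ‖evalSys (fun j => weylPoly (X j ω)) x‖}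
      ≤ Real.exp (-(g ^ 2 / (8 * K ^ 2))) * 3 ^ m * (40 * d ^ 2) ^ n := by
  have hd' : (0 : ℝ) < d := by exact_mod_cast hd
  have hG : MeasurableSet {p : Ω × EuclideanSpace ℝ (Fin n) |
      g / 2 ≤ ‖evalSys (fun j => weylPoly (X j p.1)) (toSphere p.2)‖} :=
    measurableSet_le measurable_const (measurable_evalSys_toSphere hX).norm
  have h := measureReal_le_of_volume (μ := μ) hG
    (p := Real.exp (-((g / 2) ^ 2 / (2 * K ^ 2))) * 3 ^ m) (v := (1 / (20 * d ^ 2)) ^ n)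
    (B := {ω | ∃ x, ‖x‖ = 1 ∧ g ≤ ‖evalSys (fun j => weylPoly (X j ω)) x‖})
    (by positivity) (by positivity)
    (fun w hw => measure_le_norm_evalSys_le hX hind hK hsg (norm_toSphere hw) (by positivity))
    (fun ω ⟨x, hx, hgx⟩ => exists_large_large_set
      (fun j => (totalDegree_weylPoly_le (X j ω)).trans (hdeg j)) hd hx hgx)
  have e1 : (g / 2) ^ 2 / (2 * K ^ 2) = g ^ 2 / (8 * K ^ 2) := by
    field_simp
    norm_num
  have e2 : (2 : ℝ) / (1 / (20 * d ^ 2)) = 40 * d ^ 2 := by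
    field_simp
    norm_num
  rwa [mul_div_assoc, ← div_pow, e1, e2] at h

/-- The probability that a bounded random system and one of its directional derivatives are small
at some point of the sphere. -/
theorem measureReal_exists_small_le {d : ℕ} (hn : 2 ≤ n) (hm : 1 ≤ m) (hd : 1 ≤ d)
    (hdeg : ∀ j, deg j ≤ d) (hX : ∀ j, Measurable (X j)) (hind : iIndepFun X μ) (hc₀ : 0 < c₀)
    (hsb : ∀ j, SmallBallVec μ (X j) c₀) {α γ : ℝ} (hα : 0 < α) (hαγ : α ≤ γ) :
    μ.real {ω | (∀ x, ‖x‖ = 1 → ‖evalSys (fun j => weylPoly (X j ω)) x‖ ≤ γ) ∧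
        ∃ x y : EuclideanSpace ℝ (Fin n), ‖x‖ = 1 ∧ ‖y‖ = 1 ∧ inner ℝ x y = 0 ∧
          ‖evalSys (fun j => weylPoly (X j ω)) x‖ ≤ α ∧
          ‖dirDeriv (fun j => weylPoly (X j ω)) x y‖ ≤ Real.sqrt d * α}
      ≤ (4 * Real.exp 1 * c₀ * α / Real.sqrt m) ^ m * (40 * d ^ 2) ^ n
        * (γ / α) ^ ((n : ℝ) - 3 / 2) := by
  have hγ0 : 0 < γ := hα.trans_le hαγ
  have hd' : (1 : ℝ) ≤ d := by exact_mod_cast hd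
  have hd0 : (0 : ℝ) < d := by linarith
  have hd2 : (1 : ℝ) ≤ (d : ℝ) ^ 2 := one_le_pow₀ hd'
  -- The semi-axes are fitted to the error terms: `δ` of order `s` makes the quadratic remainder of
  -- order `α`, and `ε` of order `s²` makes the transverse error exactly `α/2`. The volume carries
  -- `s · (s²)^(n-2) = (α/γ)^(n-3/2)`; `α ≤ γ` gives `s ≤ 1`, which keeps both axes short enough.
  set s : ℝ := Real.sqrt (α / γ) with hs
  have hs0 : 0 < s := Real.sqrt_pos.2 (by positivity)
  have hs2 : s ^ 2 = α / γ := Real.sq_sqrt (by positivity)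
  have hs1 : s ≤ 1 := Real.sqrt_le_one.2 ((div_le_one hγ0).2 hαγ)
  have hG : MeasurableSet {p : Ω × EuclideanSpace ℝ (Fin n) |
      ‖evalSys (fun j => weylPoly (X j p.1)) (toSphere p.2)‖ ≤ 2 * α} :=
    measurableSet_le (measurable_evalSys_toSphere hX).norm measurable_const
  set δ : ℝ := s / (4 * d ^ 2) with hδ
  set ε : ℝ := s ^ 2 / (20 * d ^ 2) with hε
  have hδ0 : 0 < δ := by positivity
  have hε0 : 0 < ε := by positivity
  have h := measureReal_le_of_volume (μ := μ) hG
    (p := (2 * Real.exp 1 * c₀ * (2 * α) / Real.sqrt m) ^ m) (v := 1 / 4 * δ * ε ^ (n - 2))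
    (B := {ω | (∀ x, ‖x‖ = 1 → ‖evalSys (fun j => weylPoly (X j ω)) x‖ ≤ γ) ∧
        ∃ x y : EuclideanSpace ℝ (Fin n), ‖x‖ = 1 ∧ ‖y‖ = 1 ∧ inner ℝ x y = 0 ∧
          ‖evalSys (fun j => weylPoly (X j ω)) x‖ ≤ α ∧
          ‖dirDeriv (fun j => weylPoly (X j ω)) x y‖ ≤ Real.sqrt d * α})
    (by positivity) (by positivity)
    (fun w hw => measure_norm_evalSys_le_le hm hX hind hc₀ hsb (norm_toSphere hw) (by positivity))
    (fun ω ⟨hγ, x, y, hx, hy, hxy, hPx, hPy⟩ => by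
      refine exists_large_small_set hn
        (fun j => (totalDegree_weylPoly_le (X j ω)).trans (hdeg j)) hd hγ hx hy hxy hα hδ0.le
        hε0.le ?_ ?_ ?_ ?_ hPx hPy
      · calc d * δ = s / (4 * d) := by rw [hδ]; field_simp
          _ ≤ 1 / (4 * 1) := by gcongr
          _ = 1 / 4 := by norm_num
      · calc 3 * d ^ 3 * γ * δ ^ 2 = 3 / 16 * (α / d) := by
              rw [hδ, div_pow, hs2]; field_simp; norm_num
          _ ≤ 3 / 16 * (α / 1) := by gcongr
          _ ≤ α / 5 := by linarith
      · calc ε ≤ 1 ^ 2 / (20 * 1) := by rw [hε]; gcongr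
          _ ≤ 1 / 4 := by norm_num
      · apply le_of_eq
        rw [hε, hs2]; field_simp; norm_num)
  refine h.trans ?_
  obtain ⟨k, rfl⟩ : ∃ k, n = k + 2 := ⟨n - 2, by omega⟩
  have hpow : (γ / α) ^ (((k + 2 : ℕ) : ℝ) - 3 / 2) = 1 / (s * (s ^ 2) ^ k) := by
    rw [hs2, hs, Real.sqrt_eq_rpow, ← Real.rpow_natCast (α / γ) k,
      ← Real.rpow_add (by positivity), one_div, ← Real.inv_rpow (by positivity), inv_div]
    congr 1
    push_cast
    ring
  rw [hpow, Nat.add_sub_cancel]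
  have h20 : (0 : ℝ) < (20 * d ^ 2) ^ k := by positivity
  have hv : (2 : ℝ) ^ (k + 2) / (1 / 4 * δ * ε ^ k)
      = 64 * d ^ 2 * (40 * d ^ 2) ^ k * (1 / (s * (s ^ 2) ^ k)) := by
    have e1 : (40 * (d : ℝ) ^ 2) ^ k = 2 ^ k * (20 * d ^ 2) ^ k := by
      rw [← mul_pow]; congr 1; ring
    rw [e1, hδ, hε, div_pow (s ^ 2), pow_add]
    field_simp
    ring
  rw [mul_div_assoc, hv]
  have e2 : 2 * Real.exp 1 * c₀ * (2 * α) = 4 * Real.exp 1 * c₀ * α := by ring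
  rw [e2, mul_assoc ((4 * Real.exp 1 * c₀ * α / Real.sqrt m) ^ m)]
  gcongr
  have e3 : (40 * (d : ℝ) ^ 2) ^ (k + 2) = 1600 * (d ^ 2) ^ 2 * (40 * d ^ 2) ^ k := by ring
  have e4 : 64 * (d : ℝ) ^ 2 ≤ 1600 * (d ^ 2) ^ 2 := by nlinarith
  rw [e3]
  gcongr

end System

/-! ### Comparison of the constants with the normalizer `M`. -/

section Constants

variable {n m : ℕ} {d L N r A : ℝ}

/-- All factors of `M` other than the first are at least 1. The bound serves to guarantee `α ≤ γ`
for the final parameters. -/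
theorem sqrt_div_le_normalizer (hn : 2 ≤ n) (hnm : n ≤ m + 1) (hd : 1 ≤ d) (hL : 1 ≤ L)
    (hA : 1 ≤ A) (hr : r = (m : ℝ) - n + 3 / 2) :
    Real.sqrt (N / m) ≤ Real.sqrt (N / m) * A ^ ((m : ℝ) / r) *
        (3 * d ^ 2 * L) ^ (((n : ℝ) - 3 / 2) / r) *
        (n : ℝ) ^ (1 / (2 * (m : ℝ) - 2 * n + 3)) * max (d ^ 6) (n / d ^ 2) := by
  have hnR : (2 : ℝ) ≤ n := by exact_mod_cast hn
  have hnmR : (n : ℝ) ≤ m + 1 := by exact_mod_cast hnm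
  have hr0 : 0 < r := by linarith
  have hd2 : 1 ≤ d ^ 2 := one_le_pow₀ hd
  have hA0 : 0 < A := by linarith
  have hL0 : 0 < L := by linarith
  have h1 : 1 ≤ A ^ ((m : ℝ) / r) := Real.one_le_rpow hA (by positivity)
  have h2 : 1 ≤ (3 * d ^ 2 * L) ^ (((n : ℝ) - 3 / 2) / r) :=
    Real.one_le_rpow (by nlinarith) (div_nonneg (by linarith) hr0.le)
  have h3 : 1 ≤ (n : ℝ) ^ (1 / (2 * (m : ℝ) - 2 * n + 3)) :=
    Real.one_le_rpow (by linarith) (div_nonneg zero_le_one (by linarith))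
  have h4 : 1 ≤ max (d ^ 6) (n / d ^ 2) := le_max_of_le_left (one_le_pow₀ hd)
  have hs : 0 ≤ Real.sqrt (N / m) := Real.sqrt_nonneg _
  refine le_trans ?_ (le_mul_of_one_le_right (by positivity) h4)
  refine le_trans ?_ (le_mul_of_one_le_right (by positivity) h3)
  refine le_trans ?_ (le_mul_of_one_le_right (by positivity) h2)
  exact le_mul_of_one_le_right hs h1

/-- Everything independent of `t` is compared with `M^r`. Since `m = r + (n - 3/2)`, the factor
`√m^m` from the small-ball bound splits: one part matches `√(N/m)^r`, the other cancels the `√m` in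
`√(mL)^(n-3/2)`. -/
theorem const_le_normalizer_rpow (hn : 2 ≤ n) (hnm : n ≤ m + 1) (hd : 1 ≤ d) (hL : 1 ≤ L)
    (hN : 0 < N) {K c₀ : ℝ} (hK : 0 < K) (hc₀ : 0 < c₀) (hr : r = (m : ℝ) - n + 3 / 2) :
    (4 * Real.exp 1 * c₀ / Real.sqrt m) ^ m * (40 * d ^ 2) ^ n * 12 ^ r *
      25 ^ ((n : ℝ) - 3 / 2) * K ^ m * Real.sqrt N ^ r * Real.sqrt (m * L) ^ ((n : ℝ) - 3 / 2)
    ≤ (Real.sqrt (N / m) * (K * c₀ * 10 ^ 6) ^ ((m : ℝ) / r) *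
        (3 * d ^ 2 * L) ^ (((n : ℝ) - 3 / 2) / r) *
        (n : ℝ) ^ (1 / (2 * (m : ℝ) - 2 * n + 3)) * max (d ^ 6) (n / d ^ 2)) ^ r := by
  have hnR : (2 : ℝ) ≤ n := by exact_mod_cast hn
  have hnmR : (n : ℝ) ≤ m + 1 := by exact_mod_cast hnm
  have hm0 : (0 : ℝ) < m := by linarith
  have hr0 : 0 < r := by linarith
  have hr1 : 1 / 2 ≤ r := by linarith
  have hd0 : 0 < d := by linarith
  have hL0 : 0 < L := by linarith
  have hs0 : 0 < Real.sqrt m := Real.sqrt_pos.2 hm0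
  have hmax : 0 < max (d ^ 6) (n / d ^ 2) := lt_max_of_lt_left (by positivity)
  set e : ℝ := (n : ℝ) - 3 / 2 with he
  have he0 : 0 ≤ e := by linarith
  have hre : (m : ℝ) = r + e := by rw [hr, he]; ring
  have hM : (Real.sqrt (N / m) * (K * c₀ * 10 ^ 6) ^ ((m : ℝ) / r) *
        (3 * d ^ 2 * L) ^ (e / r) *
        (n : ℝ) ^ (1 / (2 * (m : ℝ) - 2 * n + 3)) * max (d ^ 6) (n / d ^ 2)) ^ r
      = Real.sqrt N ^ r / Real.sqrt m ^ r * (K * c₀ * 10 ^ 6) ^ m * (3 * d ^ 2 * L) ^ e *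
        (n : ℝ) ^ (1 / 2 : ℝ) * max (d ^ 6) (n / d ^ 2) ^ r := by
    rw [Real.mul_rpow (by positivity) hmax.le, Real.mul_rpow (by positivity) (by positivity),
      Real.mul_rpow (by positivity) (by positivity), Real.mul_rpow (by positivity) (by positivity),
      ← Real.rpow_mul (by positivity), ← Real.rpow_mul (by positivity),
      ← Real.rpow_mul (by positivity), div_mul_cancel₀ _ hr0.ne', div_mul_cancel₀ _ hr0.ne',
      Real.rpow_natCast, Real.sqrt_div hN.le, Real.div_rpow (by positivity) (by positivity)]
    congr 3
    have : 2 * (m : ℝ) - 2 * n + 3 = 2 * r := by rw [hr]; ring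
    rw [this]
    field_simp
  have hsm : Real.sqrt m ^ m = Real.sqrt m ^ r * Real.sqrt m ^ e := by
    rw [← Real.rpow_natCast, ← Real.rpow_add hs0, ← hre]
  -- Here `25 ≤ 12 · 3`: the 3 comes from the base `3 d² log(ed)` of the normalizer.
  have h25 : (12 : ℝ) ^ r * 25 ^ e ≤ 12 ^ m * 3 ^ e := by
    have h1 : (12 : ℝ) ^ m = 12 ^ r * 12 ^ e := by
      rw [← Real.rpow_natCast, ← Real.rpow_add (by norm_num), ← hre]
    rw [h1, mul_assoc, ← Real.mul_rpow (by norm_num) (by norm_num)]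
    gcongr
    norm_num
  have h40 : (40 * d ^ 2) ^ n ≤ 1600 ^ m * ((d ^ 2) ^ e * max (d ^ 6) (n / d ^ 2) ^ r) := by
    have h1 : (40 : ℝ) ^ n ≤ 1600 ^ m := by
      rw [show (1600 : ℝ) = 40 ^ 2 by norm_num, ← pow_mul]
      exact pow_le_pow_right₀ (by norm_num) (by omega)
    -- The surplus `d³` over `(d²)^(n-3/2)` is at most `d^(6r)` because `r ≥ 1/2`; the entry `d^6`
    -- of the maximum absorbs it.
    have h2 : (d ^ 2) ^ n ≤ (d ^ 2) ^ e * max (d ^ 6) (n / d ^ 2) ^ r := by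
      calc (d ^ 2) ^ n = (d ^ 2) ^ e * (d ^ 2) ^ (3 / 2 : ℝ) := by
            rw [← Real.rpow_add (by positivity), ← Real.rpow_natCast]
            congr 1
            rw [he]; ring
        _ ≤ (d ^ 2) ^ e * (d ^ 2) ^ (3 * r) := by
            gcongr
            · exact one_le_pow₀ hd
            · linarith
        _ = (d ^ 2) ^ e * (d ^ 6) ^ r := by
            rw [Real.rpow_mul (by positivity)]
            congr 2
            rw [show (3 : ℝ) = ((3 : ℕ) : ℝ) by norm_num, Real.rpow_natCast]
            ring
        _ ≤ _ := by
            gcongr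
            exact le_max_left _ _
    rw [mul_pow]
    gcongr
  have hLe : Real.sqrt L ^ e ≤ L ^ e := by
    gcongr
    exact Real.sqrt_le_iff.2 ⟨hL0.le, by nlinarith⟩
  have hn1 : 1 ≤ (n : ℝ) ^ (1 / 2 : ℝ) := Real.one_le_rpow (by linarith) (by norm_num)
  have hexp : (4 * Real.exp 1 * c₀) ^ m * 1600 ^ m * 12 ^ m * K ^ m ≤ (K * c₀ * 10 ^ 6) ^ m := by
    rw [← mul_pow, ← mul_pow, ← mul_pow]
    have h1 : 4 * Real.exp 1 * 1600 * 12 ≤ (10 : ℝ) ^ 6 := by linarith [Real.exp_one_lt_d9]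
    refine pow_le_pow_left₀ (by positivity) ?_ m
    calc 4 * Real.exp 1 * c₀ * 1600 * 12 * K = K * c₀ * (4 * Real.exp 1 * 1600 * 12) := by ring
      _ ≤ K * c₀ * 10 ^ 6 := by gcongr
  rw [hM, Real.mul_rpow (by positivity) (by positivity), Real.mul_rpow (by norm_num) (by positivity),
    Real.sqrt_mul hm0.le, Real.mul_rpow (by positivity) (by positivity), div_pow, hsm]
  calc (4 * Real.exp 1 * c₀) ^ m / (Real.sqrt m ^ r * Real.sqrt m ^ e) * (40 * d ^ 2) ^ n * 12 ^ r *
        25 ^ e * K ^ m * Real.sqrt N ^ r * (Real.sqrt m ^ e * Real.sqrt L ^ e)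
      = (Real.sqrt N ^ r / Real.sqrt m ^ r) * ((4 * Real.exp 1 * c₀) ^ m * K ^ m) *
          (40 * d ^ 2) ^ n * (12 ^ r * 25 ^ e) * Real.sqrt L ^ e * 1 := by
        have : Real.sqrt m ^ e ≠ 0 := (Real.rpow_pos_of_pos hs0 _).ne'
        field_simp
    _ ≤ (Real.sqrt N ^ r / Real.sqrt m ^ r) * ((4 * Real.exp 1 * c₀) ^ m * K ^ m) *
          (1600 ^ m * ((d ^ 2) ^ e * max (d ^ 6) (n / d ^ 2) ^ r)) * (12 ^ m * 3 ^ e) * L ^ e *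
          (n : ℝ) ^ (1 / 2 : ℝ) := by gcongr
    _ = (Real.sqrt N ^ r / Real.sqrt m ^ r) *
          ((4 * Real.exp 1 * c₀) ^ m * 1600 ^ m * 12 ^ m * K ^ m) * (3 ^ e * (d ^ 2) ^ e * L ^ e) *
          (n : ℝ) ^ (1 / 2 : ℝ) * max (d ^ 6) (n / d ^ 2) ^ r := by ring
    _ ≤ _ := by gcongr

/-- The bound for a small system, with the parameters of the tail bounds inserted. -/
theorem small_system_bound_le (hn : 2 ≤ n) (hnm : n ≤ m + 1) (hd : 1 ≤ d) (hL : 1 ≤ L)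
    (hN : 0 < N) {K c₀ : ℝ} (hK : 0 < K) (hc₀ : 0 < c₀) (hr : r = (m : ℝ) - n + 3 / 2)
    {M t s u : ℝ} (hM0 : 0 < M) (hM : M = Real.sqrt (N / m) * (K * c₀ * 10 ^ 6) ^ ((m : ℝ) / r) *
        (3 * d ^ 2 * L) ^ (((n : ℝ) - 3 / 2) / r) *
        (n : ℝ) ^ (1 / (2 * (m : ℝ) - 2 * n + 3)) * max (d ^ 6) (n / d ^ 2)) (ht : 0 < t)
    (hs : 0 < s) (hu : 0 < u) {α γ : ℝ} (hα : α = 12 * K * (Real.sqrt N * s) / (t * M))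
    (hγ : γ = 25 * K * (Real.sqrt (m * L) * u)) :
    (4 * Real.exp 1 * c₀ * α / Real.sqrt m) ^ m * (40 * d ^ 2) ^ n * (γ / α) ^ ((n : ℝ) - 3 / 2)
      ≤ 1 / t ^ r * (s ^ r * u ^ ((n : ℝ) - 3 / 2)) := by
  have key := const_le_normalizer_rpow hn hnm hd hL hN hK hc₀ hr
  rw [← hM] at key
  have hm0 : (0 : ℝ) < m := by
    have : 0 < m := by omega
    exact_mod_cast this
  have hL0 : 0 < L := by linarith
  set e : ℝ := (n : ℝ) - 3 / 2 with he
  have hre : (m : ℝ) = r + e := by rw [hr, he]; ring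
  have hsN : 0 < Real.sqrt N := Real.sqrt_pos.2 hN
  have hsl : 0 < Real.sqrt (m * L) := Real.sqrt_pos.2 (by positivity)
  have hα0 : 0 < α := by rw [hα]; positivity
  have hKm : K ^ m = K ^ r * K ^ e := by
    rw [← Real.rpow_natCast, ← Real.rpow_add hK, ← hre]
  have hαm : α ^ m = α ^ r * α ^ e := by
    rw [← Real.rpow_natCast, ← Real.rpow_add hα0, ← hre]
  have hαr : α ^ r = 12 ^ r * K ^ r * (Real.sqrt N ^ r * s ^ r) / (t ^ r * M ^ r) := by
    rw [hα, Real.div_rpow (by positivity) (by positivity), Real.mul_rpow (by positivity)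
      (by positivity), Real.mul_rpow (by positivity) (by positivity), Real.mul_rpow (by positivity)
      (by positivity), Real.mul_rpow (by positivity) (by positivity)]
  have hγe : γ ^ e = 25 ^ e * K ^ e * (Real.sqrt (m * L) ^ e * u ^ e) := by
    rw [hγ, Real.mul_rpow (by positivity) (by positivity), Real.mul_rpow (by positivity)
      (by positivity), Real.mul_rpow (by positivity) (by positivity)]
  have hγ0 : 0 ≤ γ := by rw [hγ]; positivity
  have hMr : 0 < M ^ r := Real.rpow_pos_of_pos hM0 _
  have htr : 0 < t ^ r := Real.rpow_pos_of_pos ht _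
  have hαe : α ^ e ≠ 0 := (Real.rpow_pos_of_pos hα0 _).ne'
  calc (4 * Real.exp 1 * c₀ * α / Real.sqrt m) ^ m * (40 * d ^ 2) ^ n * (γ / α) ^ e
      = (4 * Real.exp 1 * c₀ / Real.sqrt m) ^ m * α ^ m * (40 * d ^ 2) ^ n * (γ ^ e / α ^ e) := by
        rw [Real.div_rpow hγ0 hα0.le, ← mul_pow]
        congr 3
        ring
    -- The exponents combine as `α^m (γ/α)^e = α^r γ^e`.
    _ = (4 * Real.exp 1 * c₀ / Real.sqrt m) ^ m * (40 * d ^ 2) ^ n * (α ^ r * γ ^ e) := by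
        rw [hαm]
        field_simp
    _ = ((4 * Real.exp 1 * c₀ / Real.sqrt m) ^ m * (40 * d ^ 2) ^ n * 12 ^ r *
          25 ^ e * K ^ m * Real.sqrt N ^ r * Real.sqrt (m * L) ^ e) / M ^ r *
          (1 / t ^ r * (s ^ r * u ^ e)) := by
        rw [hαr, hγe, hKm]
        field_simp
    _ ≤ 1 * (1 / t ^ r * (s ^ r * u ^ e)) := by
        gcongr
        exact (div_le_one hMr).2 key
    _ = _ := one_mul _

end Constants

/-! ### Choice of parameters and assembly. -/

theorem exp_neg_mul_log {t : ℝ} (ht : 0 < t) (r : ℝ) : Real.exp (-(r * Real.log t)) = 1 / t ^ r := by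
  rw [Real.exp_neg, Real.rpow_def_of_pos ht, one_div, mul_comm]

/-- The entropy factor is at most `(4800 d⁴)^m ≤ (ed)^(9m) ≤ exp(9v)`, which the exponent `10v`
beats by `exp(-v)`. -/
theorem sup_tail_bound_le {n m d : ℕ} (hnm : n ≤ m + 1) (hm : 1 ≤ m) (hd : 1 ≤ d) {q v : ℝ}
    (hv : m * Real.log (Real.exp 1 * d) ≤ v) (hq : q ≤ v) :
    Real.exp (-(10 * v)) * 3 ^ m * (40 * (d : ℝ) ^ 2) ^ n ≤ Real.exp (-q) := by
  have hd' : (1 : ℝ) ≤ d := by exact_mod_cast hd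
  have hd2 : (1 : ℝ) ≤ (d : ℝ) ^ 2 := one_le_pow₀ hd'
  have h1 : (40 * (d : ℝ) ^ 2) ^ n ≤ (1600 * (d : ℝ) ^ 4) ^ m := by
    rw [show (1600 * (d : ℝ) ^ 4) = (40 * (d : ℝ) ^ 2) ^ 2 by ring, ← pow_mul]
    exact pow_le_pow_right₀ (by linarith) (by omega)
  have h2 : 3 * (1600 * (d : ℝ) ^ 4) ≤ (Real.exp 1 * d) ^ 9 := by
    have he : (4800 : ℝ) ≤ Real.exp 1 ^ 9 := by
      calc (4800 : ℝ) ≤ 2.7 ^ 9 := by norm_num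
        _ ≤ Real.exp 1 ^ 9 := by
          gcongr
          linarith [Real.exp_one_gt_d9]
    have hd9 : (d : ℝ) ^ 4 ≤ (d : ℝ) ^ 9 := pow_le_pow_right₀ hd' (by norm_num)
    calc 3 * (1600 * (d : ℝ) ^ 4) = 4800 * (d : ℝ) ^ 4 := by ring
      _ ≤ Real.exp 1 ^ 9 * (d : ℝ) ^ 9 := by gcongr
      _ = _ := by ring
  have h3 : 3 ^ m * (40 * (d : ℝ) ^ 2) ^ n ≤ Real.exp (9 * v) := by
    calc 3 ^ m * (40 * (d : ℝ) ^ 2) ^ n ≤ 3 ^ m * (1600 * (d : ℝ) ^ 4) ^ m := by gcongr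
      _ = (3 * (1600 * (d : ℝ) ^ 4)) ^ m := (mul_pow _ _ _).symm
      _ ≤ ((Real.exp 1 * d) ^ 9) ^ m := by gcongr
      _ = Real.exp (9 * (m * Real.log (Real.exp 1 * d))) := by
          have hpos : 0 < Real.exp 1 * (d : ℝ) := by positivity
          rw [← pow_mul, ← Real.exp_log (pow_pos hpos (9 * m)), Real.log_pow]
          push_cast
          congr 1
          ring
      _ ≤ Real.exp (9 * v) := Real.exp_le_exp.2 (by linarith)
  calc Real.exp (-(10 * v)) * 3 ^ m * (40 * (d : ℝ) ^ 2) ^ n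
      = Real.exp (-(10 * v)) * (3 ^ m * (40 * (d : ℝ) ^ 2) ^ n) := by ring
    _ ≤ Real.exp (-(10 * v)) * Real.exp (9 * v) := by gcongr
    _ = Real.exp (-v) := by rw [← Real.exp_add]; congr 1; ring
    _ ≤ Real.exp (-q) := Real.exp_le_exp.2 (by linarith)

theorem weyl_tail_bound_le {N : ℕ} {q v : ℝ} (hv : N ≤ v) (hq : q ≤ v) :
    Real.exp (-(4 * v)) * 12 ^ N ≤ Real.exp (-q) := by
  have h1 : (12 : ℝ) ^ N ≤ Real.exp (3 * v) := by
    calc (12 : ℝ) ^ N ≤ (Real.exp 1 ^ 3) ^ N := by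
          gcongr
          calc (12 : ℝ) ≤ 2.7 ^ 3 := by norm_num
            _ ≤ Real.exp 1 ^ 3 := by
              gcongr
              linarith [Real.exp_one_gt_d9]
      _ = Real.exp (3 * N) := by
          rw [← pow_mul, ← Real.exp_nat_mul]
          push_cast
          rw [mul_one]
      _ ≤ Real.exp (3 * v) := Real.exp_le_exp.2 (by linarith)
  calc Real.exp (-(4 * v)) * 12 ^ N ≤ Real.exp (-(4 * v)) * Real.exp (3 * v) := by gcongr
    _ = Real.exp (-v) := by rw [← Real.exp_add]; congr 1; ring
    _ ≤ Real.exp (-q) := Real.exp_le_exp.2 (by linarith)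

/-- The failure probability is at most the sum of the tails of the Weyl norm and of the sup norm, and
of the probability that a bounded system is small somewhere. -/
theorem measureReal_condGlobal_le_add {n m : ℕ} (hn : 2 ≤ n) (hm : 1 ≤ m) {deg : Fin m → ℕ} {d : ℕ}
    (hd1 : 1 ≤ d) (hdeg : ∀ j, 1 ≤ deg j) (hd : ∀ j, deg j ≤ d) {Ω : Type*} [MeasurableSpace Ω]
    {μ : Measure Ω} [IsProbabilityMeasure μ] {X : ∀ j : Fin m, Ω → EuclideanSpace ℝ (WExp n (deg j))}
    (hX : ∀ j, Measurable (X j)) (hind : iIndepFun X μ) {K c₀ : ℝ} (hK : 0 < K) (hc₀ : 0 < c₀)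
    (hsg : ∀ j, SubGaussianVec μ (X j) K) (hsb : ∀ j, SmallBallVec μ (X j) c₀) {N : ℕ}
    (hN : N = ∑ j, (n + deg j - 1).choose (deg j)) {α γ v s : ℝ} (hα : 0 < α) (hαγ : α ≤ γ)
    (hv : 0 ≤ v) (hs : 0 < s) (hαs : 2 * (Real.sqrt (8 * v) * K) ≤ α * s) :
    μ.real {ω | ENNReal.ofReal s ≤ condGlobal deg (fun j => weylPoly (X j ω))}
      ≤ Real.exp (-v) * 12 ^ N + Real.exp (-(γ ^ 2 / (8 * K ^ 2))) * 3 ^ m * (40 * d ^ 2) ^ n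
        + (4 * Real.exp 1 * c₀ * α / Real.sqrt m) ^ m * (40 * d ^ 2) ^ n
          * (γ / α) ^ ((n : ℝ) - 3 / 2) := by
  refine le_trans ?_ (add_le_add (add_le_add
    (measureReal_weylNormSys_tail (by omega : 1 ≤ n) hX hind hK hsg hN v hv)
    (measureReal_sup_evalSys_tail hd1 hd hX hind hK hsg (hα.le.trans hαγ)))
    (measureReal_exists_small_le hn hm hd1 hd hX hind hc₀ hsb hα hαγ))
  refine le_trans (measureReal_mono ?_) ((measureReal_union_le _ _).trans
    (add_le_add_left (measureReal_union_le _ _) _))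
  intro ω hω
  rcases le_or_gt (Real.sqrt (8 * v) * K) (weylNormSys deg fun j => weylPoly (X j ω)) with h1 | h1
  · exact Or.inl (Or.inl h1)
  by_cases h2 : ∃ x, ‖x‖ = 1 ∧ γ ≤ ‖evalSys (fun j => weylPoly (X j ω)) x‖
  · exact Or.inl (Or.inr h2)
  refine Or.inr ⟨fun x hx => le_of_not_ge fun h3 => h2 ⟨x, hx, h3⟩, ?_⟩
  exact exists_small_of_le_condGlobal hn deg hdeg hd _ hs (by linarith) hω

/-- The probability bound with both tail factors `max 1 (q / N)` and `max 1 (q / l)`, `q = r log t`,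
kept explicit. -/
theorem measureReal_condGlobal_le {n m : ℕ} (hn : 2 ≤ n) (hnm : n ≤ m + 1) {deg : Fin m → ℕ}
    (hdeg : ∀ j, 1 ≤ deg j) {Ω : Type*} [MeasurableSpace Ω] {μ : Measure Ω}
    [IsProbabilityMeasure μ] {X : ∀ j : Fin m, Ω → EuclideanSpace ℝ (WExp n (deg j))}
    (hX : ∀ j, Measurable (X j)) (hind : iIndepFun X μ) {K c₀ : ℝ} (hK : 0 < K) (hc₀ : 0 < c₀)
    (hsg : ∀ j, SubGaussianVec μ (X j) K) (hsb : ∀ j, SmallBallVec μ (X j) c₀)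
    {d : ℕ} (hd1 : 1 ≤ d) (hd : ∀ j, deg j ≤ d) {Nn : ℕ}
    (hNn : Nn = ∑ j, (n + deg j - 1).choose (deg j)) {N r l M t : ℝ} (hN : N = Nn)
    (hr : r = (m : ℝ) - n + 3 / 2) (hl : l = m * Real.log (Real.exp 1 * d))
    (hM : M = Real.sqrt (N / m) * (K * c₀ * 10 ^ 6) ^ ((m : ℝ) / r) *
        (3 * (d : ℝ) ^ 2 * Real.log (Real.exp 1 * d)) ^ (((n : ℝ) - 3 / 2) / r) *
        (n : ℝ) ^ (1 / (2 * (m : ℝ) - 2 * n + 3)) * max ((d : ℝ) ^ 6) (n / (d : ℝ) ^ 2))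
    (ht : 1 ≤ t) :
    μ.real {ω | ENNReal.ofReal (t * M) ≤ condGlobal deg (fun j => weylPoly (X j ω))}
      ≤ 3 / t ^ r * (max 1 (r * Real.log t / N) ^ (r / 2) *
        max 1 (r * Real.log t / l) ^ (((n : ℝ) - 3 / 2) / 2)) := by
  have hm : 1 ≤ m := by omega
  have hm0 : (0 : ℝ) < m := by exact_mod_cast hm
  have hnR : (2 : ℝ) ≤ n := by exact_mod_cast hn
  have hnmR : (n : ℝ) ≤ m + 1 := by exact_mod_cast hnm
  have hr0 : 0 < r := by linarith
  have hd' : (1 : ℝ) ≤ d := by exact_mod_cast hd1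
  have hL : 1 ≤ Real.log (Real.exp 1 * d) := by
    rw [Real.log_mul (Real.exp_pos 1).ne' (by linarith), Real.log_exp]
    linarith [Real.log_nonneg hd']
  have hml : (m : ℝ) ≤ l := by rw [hl]; nlinarith
  have hl0 : 0 < l := by linarith
  have hmN : (m : ℝ) ≤ N := by
    rw [hN, hNn]
    have : ∑ _j : Fin m, 1 ≤ ∑ j, (n + deg j - 1).choose (deg j) :=
      Finset.sum_le_sum fun j _ => Nat.choose_pos (by have := hdeg j; omega)
    simp only [Finset.sum_const, Finset.card_univ, Fintype.card_fin, smul_eq_mul, mul_one] at this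
    exact_mod_cast this
  have hN0 : 0 < N := by linarith
  have ht0 : 0 < t := by linarith
  set q : ℝ := r * Real.log t with hq
  have hq0 : 0 ≤ q := mul_nonneg hr0.le (Real.log_nonneg ht)
  have hKc : 1 / 4 ≤ K * c₀ := by
    have j₀ : Fin m := ⟨0, hm⟩
    have : Nonempty (WExp n (deg j₀)) := by
      rw [← Fintype.card_pos_iff, card_WExp]
      exact Nat.choose_pos (by omega)
    exact one_fourth_le_mul_of_subGaussian_smallBall hK (hsg j₀) (hsb j₀)
  have hsM : Real.sqrt (N / m) ≤ M := by
    rw [hM]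
    exact sqrt_div_le_normalizer hn hnm hd' hL (by linarith) hr
  have hM0 : 0 < M := (Real.sqrt_pos.2 (by positivity)).trans_le hsM
  -- These factors give `S² = max(N, q)` and `U² = max(l, q)`, the least levels up to constants at
  -- which each tail beats both its entropy and `t^(-r) = exp(-q)`.
  set s : ℝ := Real.sqrt (max 1 (q / N)) with hs
  set u : ℝ := Real.sqrt (max 1 (q / l)) with hu
  have hmax1 : ∀ z : ℝ, 1 ≤ max 1 z := fun z => le_max_left _ _
  have hs1 : 1 ≤ s := Real.one_le_sqrt.2 (hmax1 _)
  have hu1 : 1 ≤ u := Real.one_le_sqrt.2 (hmax1 _)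
  have hSsq : (Real.sqrt N * s) ^ 2 = max N q := by
    rw [mul_pow, Real.sq_sqrt hN0.le, hs, Real.sq_sqrt (by linarith [hmax1 (q / N)]),
      mul_max_of_nonneg _ _ hN0.le, mul_one, mul_div_cancel₀ _ hN0.ne']
  have hUsq : (Real.sqrt l * u) ^ 2 = max l q := by
    rw [mul_pow, Real.sq_sqrt hl0.le, hu, Real.sq_sqrt (by linarith [hmax1 (q / l)]),
      mul_max_of_nonneg _ _ hl0.le, mul_one, mul_div_cancel₀ _ hl0.ne']
  set S : ℝ := Real.sqrt N * s with hS
  set U : ℝ := Real.sqrt l * u with hU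
  have hS0 : 0 < S := mul_pos (Real.sqrt_pos.2 hN0) (by linarith)
  have hU0 : 0 < U := mul_pos (Real.sqrt_pos.2 hl0) (by linarith)
  have hSU : S ≤ Real.sqrt (N / m) * U := by
    refine abs_le_of_sq_le_sq' ?_ (by positivity) |>.2
    rw [hSsq, mul_pow, hUsq, Real.sq_sqrt (by positivity), mul_max_of_nonneg _ _ (by positivity)]
    refine max_le_max ?_ (le_mul_of_one_le_left hq0 ((one_le_div hm0).2 hmN))
    calc N = N / m * m := by field_simp
      _ ≤ N / m * l := by gcongr
  -- Cutting the Weyl norm at `√(8 · 4S²) K ≤ 6KS` and doubling, as the deterministic step requires,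
  -- gives 12. For the sup norm, 25 suffices since `25²/8 ≥ 10`.
  set α : ℝ := 12 * K * S / (t * M) with hα
  set γ : ℝ := 25 * K * U with hγ
  have hα0 : 0 < α := by positivity
  have hαγ : α ≤ γ := by
    rw [hα, div_le_iff₀ (by positivity)]
    have h1 : S ≤ U * (t * M) := by
      calc S ≤ Real.sqrt (N / m) * U := hSU
        _ ≤ M * U := by gcongr
        _ ≤ t * (M * U) := le_mul_of_one_le_left (by positivity) ht
        _ = U * (t * M) := by ring
    calc 12 * K * S ≤ 25 * K * S := by gcongr; norm_num
      _ ≤ 25 * K * (U * (t * M)) := by gcongr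
      _ = γ * (t * M) := by rw [hγ]; ring
  have h4 : Real.sqrt (8 * (4 * S ^ 2)) ≤ 6 * S :=
    Real.sqrt_le_iff.2 ⟨by positivity, by linarith [sq_nonneg S]⟩
  have h5 := mul_le_mul_of_nonneg_right h4 hK.le
  have hαs : 2 * (Real.sqrt (8 * (4 * S ^ 2)) * K) ≤ α * (t * M) := by
    rw [hα, div_mul_cancel₀ _ (by positivity)]
    linarith
  refine (measureReal_condGlobal_le_add hn hm hd1 hdeg hd hX hind hK hc₀ hsg hsb hNn hα0 hαγ
    (v := 4 * S ^ 2) (by positivity) (by positivity) hαs).trans ?_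
  have cW : Real.exp (-(4 * S ^ 2)) * 12 ^ Nn ≤ 1 / t ^ r := by
    rw [hSsq, ← exp_neg_mul_log ht0]
    exact weyl_tail_bound_le (by rw [← hN]; exact le_max_left _ _) (le_max_right _ _)
  have cS : Real.exp (-(γ ^ 2 / (8 * K ^ 2))) * 3 ^ m * (40 * (d : ℝ) ^ 2) ^ n ≤ 1 / t ^ r := by
    rw [← exp_neg_mul_log ht0]
    refine le_trans ?_ (sup_tail_bound_le (v := max l q) hnm hm hd1 (by rw [← hl]; exact le_max_left _ _)
      (le_max_right _ _))
    gcongr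
    rw [← hUsq, hγ, le_div_iff₀ (by positivity)]
    linarith [sq_nonneg (K * U), mul_pow K U 2, mul_pow (25 * K) U 2, mul_pow 25 K 2]
  have cL := small_system_bound_le hn hnm hd' hL hN0 hK hc₀ hr hM0 hM ht0 (by linarith : 0 < s)
    (by linarith : 0 < u) hα (γ := γ) (by rw [hγ, hU, hl])
  have hsr : s ^ r = max 1 (q / N) ^ (r / 2) := by
    rw [hs, Real.sqrt_eq_rpow, ← Real.rpow_mul (by linarith [hmax1 (q / N)])]
    congr 1
    ring
  have hue : u ^ ((n : ℝ) - 3 / 2) = max 1 (q / l) ^ (((n : ℝ) - 3 / 2) / 2) := by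
    rw [hu, Real.sqrt_eq_rpow, ← Real.rpow_mul (by linarith [hmax1 (q / l)])]
    congr 1
    ring
  rw [← hsr, ← hue]
  -- The two tail terms lack this factor; inserting it puts all three summands in the same form.
  have hprod : 1 ≤ s ^ r * u ^ ((n : ℝ) - 3 / 2) :=
    one_le_mul_of_one_le_of_one_le (Real.one_le_rpow hs1 hr0.le)
      (Real.one_le_rpow hu1 (by linarith))
  have htr : 0 < 1 / t ^ r := by positivity
  calc _ ≤ 1 / t ^ r * 1 + 1 / t ^ r * 1 + 1 / t ^ r * (s ^ r * u ^ ((n : ℝ) - 3 / 2)) := by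
        rw [mul_one]
        exact add_le_add (add_le_add cW cS) cL
    _ ≤ 1 / t ^ r * (s ^ r * u ^ ((n : ℝ) - 3 / 2)) + 1 / t ^ r * (s ^ r * u ^ ((n : ℝ) - 3 / 2))
          + 1 / t ^ r * (s ^ r * u ^ ((n : ℝ) - 3 / 2)) := by gcongr
    _ = _ := by ring

theorem theorem3p6 :
    ∃ C : ℝ, 0 < C ∧
      ∀ (n m : ℕ), 2 ≤ n → n ≤ m + 1 →
      ∀ (deg : Fin m → ℕ), (∀ j, 1 ≤ deg j) →
      ∀ (Ω : Type*) [MeasurableSpace Ω] (μ : Measure Ω) [IsProbabilityMeasure μ]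
        (X : ∀ j : Fin m, Ω → EuclideanSpace ℝ (WExp n (deg j))),
        (∀ j, Measurable (X j)) → iIndepFun X μ →
      ∀ (K c₀ : ℝ), 0 < K → 0 < c₀ →
        (∀ j, SubGaussianVec μ (X j) K) → (∀ j, SmallBallVec μ (X j) c₀) →
      let d : ℝ := ((Finset.univ.sup deg : ℕ) : ℝ)
      let N : ℝ := ((∑ j, (n + deg j - 1).choose (deg j) : ℕ) : ℝ)
      let r : ℝ := (m : ℝ) - n + 3 / 2
      let l : ℝ := m * Real.log (Real.exp 1 * d)
      let M : ℝ := Real.sqrt (N / m) * (K * c₀ * C) ^ ((m : ℝ) / r) *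
        (3 * d ^ 2 * Real.log (Real.exp 1 * d)) ^ (((n : ℝ) - 3 / 2) / r) *
        (n : ℝ) ^ (1 / (2 * (m : ℝ) - 2 * n + 3)) * max (d ^ 6) (n / d ^ 2)
      let prob : ℝ → ℝ := fun s =>
        μ.real {ω | ENNReal.ofReal s ≤ condGlobal deg (fun j => weylPoly (X j ω))}
      (l ≤ N → ∀ t : ℝ,
        (1 ≤ t → t ≤ Real.exp (l / r) → prob (t * M) ≤ 3 / t ^ r) ∧
        (Real.exp (l / r) ≤ t → t ≤ Real.exp (N / r) →
          prob (t * M) ≤ 3 / t ^ r * (r * Real.log t / l) ^ (((n : ℝ) - 3 / 2) / 2)) ∧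
        (Real.exp (N / r) ≤ t →
          prob (t * M) ≤ 3 / t ^ r * (r * Real.log t / N) ^ ((m : ℝ) / 2) *
            (N / l) ^ (((n : ℝ) - 3 / 2) / 2))) ∧
      (N ≤ l → ∀ t : ℝ,
        (1 ≤ t → t ≤ Real.exp (N / r) → prob (t * M) ≤ 3 / t ^ r) ∧
        (Real.exp (N / r) ≤ t →
          prob (t * M) ≤ 3 / t ^ r * (r * Real.log t / N) ^ ((m : ℝ) / 2))) := by
  -- This value absorbs `4e · 1600 · 12`.
  refine ⟨10 ^ 6, by norm_num, ?_⟩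
  intro n m hn hnm deg hdeg Ω _ μ _ X hX hind K c₀ hK hc₀ hsg hsb d N r l M prob
  have hm : 1 ≤ m := by omega
  have hm0 : (0 : ℝ) < m := by exact_mod_cast hm
  have hdle : ∀ j, deg j ≤ Finset.univ.sup deg := fun j => Finset.le_sup (Finset.mem_univ j)
  have hd1 : 1 ≤ Finset.univ.sup deg := (hdeg ⟨0, hm⟩).trans (hdle _)
  have hdR : (1 : ℝ) ≤ d := Nat.one_le_cast.2 hd1
  have hnR : (2 : ℝ) ≤ n := by exact_mod_cast hn
  have hnmR : (n : ℝ) ≤ m + 1 := by exact_mod_cast hnm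
  have hr0 : 0 < r := by simp only [r]; linarith
  have hl0 : 0 < l := by
    refine mul_pos hm0 (Real.log_pos ?_)
    nlinarith [Real.add_one_lt_exp (one_ne_zero)]
  have hN0 : 0 < N := by
    refine Nat.cast_pos.2 (Finset.sum_pos (fun j _ => Nat.choose_pos (by have := hdeg j; omega)) ?_)
    exact ⟨⟨0, hm⟩, Finset.mem_univ _⟩
  set e : ℝ := ((n : ℝ) - 3 / 2) / 2 with he
  have he0 : 0 ≤ e := by rw [he]; linarith
  have hre : (m : ℝ) / 2 = r / 2 + e := by simp only [r, he]; ring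
  have hpow : ∀ z : ℝ, 0 < z → z ^ ((m : ℝ) / 2) = z ^ (r / 2) * z ^ e := fun z hz => by
    rw [hre, Real.rpow_add hz]
  have hpow : ∀ z : ℝ, 0 < z → z ^ ((m : ℝ) / 2) = z ^ (r / 2) * z ^ e := fun z hz => by
    rw [hre, Real.rpow_add hz]
  have main : ∀ t : ℝ, 1 ≤ t → prob (t * M) ≤ 3 / t ^ r * (max 1 (r * Real.log t / N) ^ (r / 2) *
      max 1 (r * Real.log t / l) ^ e) := fun t ht =>
    measureReal_condGlobal_le hn hnm hdeg hX hind hK hc₀ hsg hsb hd1 hdle rfl rfl rfl rfl rfl ht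
  have hone : ∀ (A t : ℝ), 0 < A → Real.exp (A / r) ≤ t → 1 ≤ t := fun A t hA h =>
    (Real.one_le_exp (by positivity)).trans h
  have hge : ∀ (A t : ℝ), 0 < A → Real.exp (A / r) ≤ t → 1 ≤ r * Real.log t / A := by
    intro A t hA h
    have := (Real.le_log_iff_exp_le (by linarith [hone A t hA h])).2 h
    rw [div_le_iff₀ hr0] at this
    rw [le_div_iff₀ hA]
    linarith
  have hle : ∀ (A t : ℝ), 0 < A → 1 ≤ t → t ≤ Real.exp (A / r) → r * Real.log t / A ≤ 1 := by
    intro A t hA ht h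
    have := (Real.log_le_iff_le_exp (by linarith)).2 h
    rw [le_div_iff₀ hr0] at this
    rw [div_le_iff₀ hA]
    linarith
  have hmono : ∀ A B : ℝ, A ≤ B → Real.exp (A / r) ≤ Real.exp (B / r) := fun A B h =>
    Real.exp_le_exp.2 (by gcongr)
  refine ⟨fun hlN t => ⟨fun ht1 ht2 => ?_, fun ht1 ht2 => ?_, fun ht1 => ?_⟩,
    fun hNl t => ⟨fun ht1 ht2 => ?_, fun ht1 => ?_⟩⟩
  · have h := main t ht1
    rwa [max_eq_left (hle N t hN0 ht1 (ht2.trans (hmono l N hlN))), max_eq_left (hle l t hl0 ht1 ht2),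
      Real.one_rpow, Real.one_rpow, mul_one, mul_one] at h
  · have ht := hone l t hl0 ht1
    have h := main t ht
    rwa [max_eq_left (hle N t hN0 ht ht2), max_eq_right (hge l t hl0 ht1), Real.one_rpow,
      one_mul] at h
  · have ht := hone N t hN0 ht1
    have h := main t ht
    have hq := hge N t hN0 ht1
    rw [max_eq_right hq, max_eq_right (hge l t hl0 ((hmono l N hlN).trans ht1))] at h
    refine h.trans_eq ?_
    -- Both maxima are active here. Factoring `q/l = (q/N)(N/l)` lets the powers of `q/N` merge into
    -- the exponent `r/2 + e = m/2`.
    have hsplit : r * Real.log t / l = r * Real.log t / N * (N / l) := by field_simp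
    rw [mul_assoc, hsplit, Real.mul_rpow (by linarith) (by positivity),
      hpow _ (by linarith)]
    ring
  · have h := main t ht1
    rwa [max_eq_left (hle N t hN0 ht1 ht2), max_eq_left (hle l t hl0 ht1 (ht2.trans (hmono N l hNl))),
      Real.one_rpow, Real.one_rpow, mul_one, mul_one] at h
  · have ht := hone N t hN0 ht1
    refine (main t ht).trans ?_
    have hq := hge N t hN0 ht1
    have hlog : 0 ≤ r * Real.log t := mul_nonneg hr0.le (Real.log_nonneg ht)
    -- When `N ≤ l` this holds whether or not `q` has passed `l`, so no separate regime beginning at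
    -- `exp(l/r)` is needed.
    have h2 : max 1 (r * Real.log t / l) ≤ r * Real.log t / N :=
      max_le hq (by gcongr)
    rw [max_eq_right hq, hpow _ (by linarith)]
    gcongr
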